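/- Let $p$ be a prime, $F$ a finite extension of $\mathbb{Q}_p$ with ring of integers $\mathcal{O}_F$, $n\ge 0$, $R=\mathcal{O}_F[[X_1,\ldots,X_n]]$, $I\subseteq R$ an ideal and $A=R/I$. Let $\mu_{p^\infty}$ be the group of roots of unity of $p$-power order in an algebraic closure $\overline F$. For a subset $S\subseteq\{1,\ldots,n\}$ and $\zeta_1,\dots,\zeta_n\in\mu_{p^\infty}$, the intersection of the hyperplanes $X_i=\zeta_i-1$ $(i\in S)$ is the closed subscheme of $\mathrm{Spec}(R)$ whose ideal is the contraction to $R$ of the ideal $(X_i+1-\zeta_i : i\in S)$ of $\mathcal{O}_L[[X_1,\ldots,X_n]]$, where $L\subset\overline F$ is a finite extension of $F$ containing the $\zeta_i$. For $S=\{1,\ldots,n\}$ this is the point of $\mathrm{Spec}(R)$ defined by $(\zeta_1-1,\ldots,\zeta_n-1)$. The special points $\mathcal{S}_A\subset\mathrm{Spec}(A)$ are the points of this last form that lie on $\mathrm{Spec}(A)$, i.e. whose prime ideal contains $I$. A multiplicative change of variables on $R$ is a finite composition of exchanges of two variables and of substitutions $$X_i\mapsto (1+X_i)\prod_{1\le j<i}(1+X_j)^{B_{ij}}-1\qquad(1\le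 i\le n),\qquad B_{ij}\in\mathbb{Z}_p,$$ where $(1+X)^{b}=\sum_{k\ge0}\binom{b}{k}X^k$. A closed subscheme of $\mathrm{Spec}(R)$ is a special multiplicative subscheme if, after a multiplicative change of variables, it is a finite union of intersections of hyperplanes $X_i=\zeta_i-1$ as above (the ideal of a union being the intersection of the ideals). Theorem. Every irreducible component of the Zariski closure of $\mathcal{S}_A$ in $\mathrm{Spec}(A)$, with its reduced structure and viewed as a closed subscheme of $\mathrm{Spec}(R)$, is a special multiplicative subscheme. -/

import Mathlib

open MvPowerSeries

namespace FormalManinMumford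

noncomputable section

/-- The ring of integers of an extension `F` of `ℚ_p`: the integral closure of `ℤ_p` in `F`. -/
abbrev Integers (p : ℕ) [Fact p.Prime] (F : Type*) [Field F] [Algebra ℤ_[p] F] :
    Subalgebra ℤ_[p] F :=
  integralClosure ℤ_[p] F

/-- The ring `𝒪_F[[X_1, …, X_n]]`. -/
abbrev PSeries (p : ℕ) [Fact p.Prime] (F : Type*) [Field F] [Algebra ℤ_[p] F] (n : ℕ) : Type _ :=
  MvPowerSeries (Fin n) (Integers p F)

section ChangeOfVariables

variable (p : ℕ) [Fact p.Prime] (O : Type*) [CommRing O] [Algebra ℤ_[p] O] {n : ℕ}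

/-- The power series `(1 + X_j) ^ b = ∑ k, binom(b, k) X_j ^ k` for a `p`-adic integer `b`. -/
def onePlusXPow (j : Fin n) (b : ℤ_[p]) : MvPowerSeries (Fin n) O :=
  (PowerSeries.binomialSeries O b).subst (X j : MvPowerSeries (Fin n) O)

theorem constantCoeff_onePlusXPow (j : Fin n) (b : ℤ_[p]) :
    constantCoeff (onePlusXPow p O j b) = 1 := by
  have h : PowerSeries.binomialSeries O b
      = (PowerSeries.binomialSeries O b - 1) + 1 := by ring
  have hs : PowerSeries.HasSubst (X j : MvPowerSeries (Fin n) O) := PowerSeries.HasSubst.X j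
  rw [onePlusXPow, h, PowerSeries.subst_add hs, map_add,
    PowerSeries.constantCoeff_subst_eq_zero (by simp) _ (by simp), zero_add,
    ← PowerSeries.coe_substAlgHom hs, map_one, map_one]

/-- The tuple `((1 + X_i) ∏_{j < i} (1 + X_j) ^ (B i j) - 1)_i`. -/
def unipotentTuple (B : Fin n → Fin n → ℤ_[p]) (i : Fin n) : MvPowerSeries (Fin n) O :=
  (1 + X i) * ∏ j ∈ Finset.Iio i, onePlusXPow p O j (B i j) - 1

theorem hasSubst_unipotentTuple (B : Fin n → Fin n → ℤ_[p]) :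
    HasSubst (unipotentTuple p O B) := by
  refine hasSubst_of_constantCoeff_zero fun i => ?_
  simp [unipotentTuple, constantCoeff_onePlusXPow]

/-- The tuple `(X_i)_i` with `X_a` and `X_b` exchanged. -/
def swapTuple (a b : Fin n) (i : Fin n) : MvPowerSeries (Fin n) O :=
  X (Equiv.swap a b i)

theorem hasSubst_swapTuple (a b : Fin n) : HasSubst (swapTuple O a b) :=
  hasSubst_of_constantCoeff_zero fun i => by simp [swapTuple]

/-- Multiplicative changes of variables on `O[[X_1, …, X_n]]`: the finite compositions of
exchanges of two variables and of substitutions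
`X_i ↦ (1 + X_i) ∏_{j < i} (1 + X_j) ^ (B i j) - 1` with `B i j ∈ ℤ_p`. -/
inductive IsMultChange : (MvPowerSeries (Fin n) O →ₐ[O] MvPowerSeries (Fin n) O) → Prop
  | id : IsMultChange (AlgHom.id O _)
  | swap_comp (a b : Fin n) {θ : MvPowerSeries (Fin n) O →ₐ[O] MvPowerSeries (Fin n) O}
      (hθ : IsMultChange θ) : IsMultChange ((substAlgHom (hasSubst_swapTuple O a b)).comp θ)
  | unipotent_comp (B : Fin n → Fin n → ℤ_[p])
      {θ : MvPowerSeries (Fin n) O →ₐ[O] MvPowerSeries (Fin n) O} (hθ : IsMultChange θ) :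
      IsMultChange ((substAlgHom (hasSubst_unipotentTuple p O B)).comp θ)

end ChangeOfVariables

section Special

variable (p : ℕ) [Fact p.Prime] (F : Type*) [Field F] [Algebra ℤ_[p] F] {n : ℕ}

/-- For an intermediate field `L` of `F̄ / F`, the inclusion
`𝒪_F[[X_1, …, X_n]] → 𝒪_L[[X_1, …, X_n]]`. -/
def extendScalars (L : IntermediateField F (AlgebraicClosure F)) :
    PSeries p F n →+* PSeries p L n :=
  MvPowerSeries.map (IsScalarTower.toAlgHom ℤ_[p] F L).mapIntegralClosure.toRingHom

/-- The ideal `(X_i - (ζ_i - 1) : i ∈ S)` of `𝒪_L[[X_1, …, X_n]]`, which cuts out the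
intersection of the hyperplanes `X_i = ζ_i - 1`, `i ∈ S`, over `𝒪_L`. -/
def hyperplanesIdeal (L : IntermediateField F (AlgebraicClosure F)) (S : Set (Fin n))
    (ζ : Fin n → Integers p L) : Ideal (PSeries p L n) :=
  Ideal.span ((fun i => X i - C (ζ i - 1)) '' S)

/-- `H` is the ideal of `𝒪_F[[X_1, …, X_n]]` of an intersection of hyperplanes `X_i = ζ_i - 1`,
`i ∈ S`, with `ζ_i` roots of unity of `p`-power order in `F̄`. The `ζ_i` need not lie in `F`: the
intersection is formed over `𝒪_L` for a finite extension `L / F` containing them, and the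
corresponding closed subscheme of `Spec 𝒪_F[[X_1, …, X_n]]` is its image, that is, its ideal
is contracted to `𝒪_F[[X_1, …, X_n]]`. -/
def IsHyperplaneIntersection (S : Set (Fin n)) (H : Ideal (PSeries p F n)) : Prop :=
  ∃ L : IntermediateField F (AlgebraicClosure F), FiniteDimensional F L ∧
    ∃ ζ : Fin n → Integers p L, (∀ i, ∃ k : ℕ, ζ i ^ p ^ k = 1) ∧
      H = (hyperplanesIdeal p F L S ζ).comap (extendScalars p F L)

/-- `P` is the point of `Spec 𝒪_F[[X_1, …, X_n]]` below a torsion point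
`(ζ_1 - 1, …, ζ_n - 1)`, that is, the contraction of `(X_1 + 1 - ζ_1, …, X_n + 1 - ζ_n)`. -/
def IsSpecialPoint (P : Ideal (PSeries p F n)) : Prop :=
  IsHyperplaneIntersection p F Set.univ P

/-- The special points of `Spec (𝒪_F[[X_1, …, X_n]] / I)`. -/
def specialPoints (I : Ideal (PSeries p F n)) : Set (PrimeSpectrum (PSeries p F n ⧸ I)) :=
  {x | IsSpecialPoint p F (x.asIdeal.comap (Ideal.Quotient.mk I))}

/-- The closed subscheme of `Spec 𝒪_F[[X_1, …, X_n]]` cut out by `J` is a special multiplicative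
subscheme: after a multiplicative change of variables it is a finite union of intersections of
hyperplanes `X_i = ζ_i - 1`. (The ideal of a finite union of closed subschemes is the intersection
of their ideals.) -/
def IsSpecialSubscheme (J : Ideal (PSeries p F n)) : Prop :=
  ∃ θ : PSeries p F n →ₐ[Integers p F] PSeries p F n, IsMultChange p (Integers p F) θ ∧
    ∃ T : Set (Ideal (PSeries p F n)), T.Finite ∧
      (∀ H ∈ T, ∃ S : Set (Fin n), IsHyperplaneIntersection p F S H) ∧
      J.map θ = sInf T

end Special

end

end FormalManinMumford

/-! Fix an ultrafilter on the set of special points and write each point as `(η ^ a_1 - 1, …, η ^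
a_n - 1)`, where `η` has exact order `p ^ N`; here `η`, `N` and the `a_i` depend on the point.
Suppose that one fixed nonzero `τ` satisfies `η ^ (∑ τ_i a_i) = 1` at almost all points. Dividing
`τ` by a coefficient of least valuation gives a combination of the `a_i` at which the power of `η`
is a root of unity of bounded order, hence constant along the ultrafilter, and a multiplicative
change of variables turns this combination into a coordinate. Repeating this
(`exists_isAdapted_generic`) leaves constant coordinates, indexed by `S`, and generic ones, which
satisfy no relation. The power series that vanish at almost all points then form exactly the ideal
of an intersection of hyperplanes, in the new variables (`exists_isMultChange_eventually_mem_ker`).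
This ideal is prime because it is defined by an ultrafilter.

Exactness is a rigidity statement, `eq_zero_of_eventually_evalCurve_eq_zero`: a nonzero series in
generic coordinates cannot vanish at almost all points. By integrality the coefficients may be taken
in `ℤ_p`, and not all divisible by `p`. Restrict to the curve `X_i = (1 + T) ^ a_i - 1`. Since `(η -
1) ^ p ^ (N - 1)` divides `p`, vanishing at `T = η - 1` forces the restriction modulo `p` to be
divisible by `T ^ p ^ (N - 1)`.

Over `𝔽_p` this is excluded by induction on the number of variables
(`eventually_not_X_pow_dvd_curve`). Choose `l` with `a_l` of least valuation `i`. The quotients `a_m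
/ a_l` have `p`-adic limits along the ultrafilter; after shearing by these limits, the other
exponents are divisible by `p ^ (i + J)` for any chosen `J`. In the expansion in powers of `X_l`,
the coefficients restrict to `p ^ (i + J)`-th powers by Frobenius, while `X_l` restricts to a series
of order `p ^ i`. For large `J` the leading terms cannot cancel, so every coefficient is itself
divisible by the high power of `T`, against the induction hypothesis.

Finally, every ultrafilter has such a prime specializing to almost all of its points. By compactness
finitely many of these primes specialize to all special points, and the components of the closure
are closures of such primes. -/

namespace FormalManinMumford

noncomputable section

/-! ### Homomorphisms on power series rings are determined by constants and variables. -/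

section Hausdorff

variable {σ O D : Type*} [CommRing O] [CommRing D]

/-- Every power series is a constant plus a combination of the variables. -/
theorem exists_eq_C_add_sum_X_mul [Fintype σ] (f : MvPowerSeries σ O) :
    ∃ g : σ → MvPowerSeries σ O, f = C (constantCoeff f) + ∑ i, X i * g i := by
  classical
  rcases isEmpty_or_nonempty σ with hσ | hσ
  · refine ⟨0, ?_⟩
    ext m
    simp [Subsingleton.elim m 0]
  have hex : ∀ m : σ →₀ ℕ, m ≠ 0 → ∃ i, m i ≠ 0 := fun m hm => by
    simpa [Finsupp.ext_iff] using hm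
  choose! pick hpick using hex
  -- `pick` assigns to each nonconstant monomial one variable dividing it, so each coefficient of
  -- `f` is used exactly once.
  let g : σ → MvPowerSeries σ O := fun i m => if pick (m + Finsupp.single i 1) = i
    then coeff (m + Finsupp.single i 1) f else 0
  have hg : ∀ i m, coeff m (g i) = if pick (m + Finsupp.single i 1) = i
    then coeff (m + Finsupp.single i 1) f else 0 := fun i m => rfl
  clear_value g
  refine ⟨g, ?_⟩
  ext m
  rw [map_add, map_sum, coeff_C]
  have hterm : ∀ i, coeff m (X i * g i) =
      if m i ≠ 0 ∧ pick m = i then coeff m f else 0 := by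
    intro i
    by_cases hi : m i = 0
    · rw [X_def, coeff_monomial_mul, if_neg]
      · simp [hi]
      · intro h
        have := h i
        simp [hi] at this
    · have hle : Finsupp.single i 1 ≤ m := by
        intro j
        rcases eq_or_ne i j with rfl | hij
        · simpa using Nat.one_le_iff_ne_zero.mpr hi
        · simp [hij]
      rw [X_def, coeff_monomial_mul, if_pos hle, one_mul, hg, tsub_add_cancel_of_le hle]
      simp [hi]
  simp_rw [hterm]
  by_cases hm : m = 0
  · subst hm
    simp
  · rw [if_neg hm, zero_add, Finset.sum_eq_single (pick m)]
    · simp [hpick m hm]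
    · intro i _ hi
      rw [if_neg]
      exact fun h => hi h.2.symm
    · simp

/-- A ring homomorphism from a power series ring that sends the variables into an ideal `J`
with `⋂ J ^ n = 0` is determined by its values at constants and variables. -/
theorem ringHom_ext_of_isHausdorff [Finite σ] (J : Ideal D) [IsHausdorff J D]
    {φ ψ : MvPowerSeries σ O →+* D} (hC : ∀ c, φ (C c) = ψ (C c))
    (hX : ∀ i, φ (X i) = ψ (X i)) (hJ : ∀ i, φ (X i) ∈ J) : φ = ψ := by
  have := Fintype.ofFinite σ
  have key : ∀ n : ℕ, ∀ f, φ f - ψ f ∈ J ^ n := by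
    intro n
    induction n with
    | zero => simp
    | succ n ih =>
      intro f
      obtain ⟨g, hg⟩ := exists_eq_C_add_sum_X_mul f
      rw [hg]
      simp only [map_add, map_sum, map_mul, hC]
      rw [add_sub_add_left_eq_sub, ← Finset.sum_sub_distrib]
      refine Ideal.sum_mem _ fun i _ => ?_
      rw [← hX, ← mul_sub, pow_succ']
      exact Ideal.mul_mem_mul (hJ i) (ih _)
  ext f
  rw [← sub_eq_zero]
  refine IsHausdorff.haus ‹_› _ fun n => ?_
  rw [SModEq.zero]
  simpa using key n f

/-- The ideal of the power series ring generated by the variables. -/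
def varsIdeal (σ O : Type*) [CommRing O] : Ideal (MvPowerSeries σ O) :=
  RingHom.ker (constantCoeff (σ := σ) (R := O))

theorem mem_varsIdeal {f : MvPowerSeries σ O} : f ∈ varsIdeal σ O ↔ constantCoeff f = 0 :=
  RingHom.mem_ker

/-- `1 + f * g` has constant coefficient `1`, hence is a unit. Together with Krull's intersection
theorem this makes all ideals closed over a noetherian base, so continuity of homomorphisms never
has to be checked. -/
theorem varsIdeal_le_jacobson : varsIdeal σ O ≤ Ideal.jacobson ⊥ := by
  intro f hf
  rw [Ideal.mem_jacobson_bot]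
  intro g
  rw [MvPowerSeries.isUnit_iff_constantCoeff]
  simp [mem_varsIdeal.mp hf]

instance isHausdorff_varsIdeal [Finite σ] [IsNoetherianRing O] :
    IsHausdorff (varsIdeal σ O) (MvPowerSeries σ O) :=
  IsHausdorff.of_le_jacobson _ _ varsIdeal_le_jacobson

end Hausdorff

/-! ### Binomial series with `p`-adic exponents. -/

section Binomial

variable (p : ℕ) [Fact p.Prime] (O : Type*) [CommRing O] [Algebra ℤ_[p] O]

/-- The power series `(1 + T) ^ b - 1`. -/
def powSubOne (b : ℤ_[p]) : PowerSeries O := PowerSeries.binomialSeries O b - 1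

theorem constantCoeff_powSubOne (b : ℤ_[p]) :
    PowerSeries.constantCoeff (powSubOne p O b) = 0 := by
  simp [powSubOne]

theorem hasSubst_powSubOne (b : ℤ_[p]) : PowerSeries.HasSubst (powSubOne p O b) :=
  PowerSeries.HasSubst.of_constantCoeff_zero' (constantCoeff_powSubOne p O b)

theorem map_binomialSeries {O' : Type*} [CommRing O'] [Algebra ℤ_[p] O'] (g : O →+* O')
    (hg : g.comp (algebraMap ℤ_[p] O) = algebraMap ℤ_[p] O') (b : ℤ_[p]) :
    PowerSeries.map g (PowerSeries.binomialSeries O b) = PowerSeries.binomialSeries O' b := by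
  ext n
  simp only [PowerSeries.coeff_map, PowerSeries.binomialSeries_coeff, Algebra.smul_def, mul_one,
    ← hg, RingHom.comp_apply]

/-- Each coefficient is continuous in `a` on both sides (on the left it is a finite sum, since
`powSubOne` has no constant term), and natural numbers, for which the identity is a power law, are
dense in `ℤ_p`. -/
theorem subst_binomialSeries_padicInt (a b : ℤ_[p]) :
    (PowerSeries.binomialSeries ℤ_[p] a).subst (powSubOne p ℤ_[p] b) =
      PowerSeries.binomialSeries ℤ_[p] (a * b) := by
  have hs := hasSubst_powSubOne p ℤ_[p] b
  have hcoe : ∀ a n, PowerSeries.coeff n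
      ((PowerSeries.binomialSeries ℤ_[p] a).subst (powSubOne p ℤ_[p] b)) =
      ∑ k ∈ Finset.range (n + 1), Ring.choose a k *
        PowerSeries.coeff n (powSubOne p ℤ_[p] b ^ k) := by
    intro a n
    rw [PowerSeries.coeff_subst' hs, finsum_eq_sum_of_support_subset (s := Finset.range (n + 1))]
    · simp
    · intro k hk
      simp only [Function.mem_support] at hk
      by_contra hk'
      refine hk ?_
      suffices h0 : PowerSeries.coeff n (powSubOne p ℤ_[p] b ^ k) = 0 by rw [h0, smul_zero]
      refine PowerSeries.coeff_of_lt_order _ ?_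
      refine lt_of_lt_of_le ?_ (PowerSeries.le_order_pow_of_constantCoeff_eq_zero k
        (constantCoeff_powSubOne p _ b))
      simp only [Finset.coe_range, Set.mem_Iio, not_lt] at hk'
      exact_mod_cast hk'
  ext n
  have hl : Continuous fun a : ℤ_[p] => PowerSeries.coeff n
      ((PowerSeries.binomialSeries ℤ_[p] a).subst (powSubOne p ℤ_[p] b)) := by
    simp_rw [hcoe]
    exact continuous_finsetSum _ fun k _ => (PadicInt.continuous_choose k).mul continuous_const
  have hr : Continuous fun a : ℤ_[p] => PowerSeries.coeff n
      (PowerSeries.binomialSeries ℤ_[p] (a * b)) := by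
    simp only [PowerSeries.binomialSeries_coeff, smul_eq_mul, mul_one]
    exact (PadicInt.continuous_choose n).comp (continuous_id.mul continuous_const)
  refine congrFun (PadicInt.denseRange_natCast.equalizer hl hr ?_) a
  funext m
  simp only [Function.comp_apply]
  congr 1
  rw [PowerSeries.binomialSeries_nat, ← PowerSeries.coe_substAlgHom hs, map_pow, map_add, map_one,
    PowerSeries.coe_substAlgHom, PowerSeries.subst_X hs, powSubOne, add_sub_cancel]
  induction m with
  | zero => simp
  | succ m ih =>
    rw [pow_succ, ih, ← PowerSeries.binomialSeries_add, Nat.cast_succ, add_mul, one_mul]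

/-- `((1 + T) ^ b) ^ a = (1 + T) ^ (a b)`. -/
theorem subst_binomialSeries (a b : ℤ_[p]) :
    (PowerSeries.binomialSeries O a).subst (powSubOne p O b) =
      PowerSeries.binomialSeries O (a * b) := by
  have h := congrArg (PowerSeries.map (algebraMap ℤ_[p] O)) (subst_binomialSeries_padicInt p a b)
  have hm : ∀ b, PowerSeries.map (algebraMap ℤ_[p] O) (PowerSeries.binomialSeries ℤ_[p] b) =
      PowerSeries.binomialSeries O b := map_binomialSeries p _ _ rfl
  rw [hm] at h
  rw [← h, ← hm]
  have h2 := PowerSeries.map_subst (hasSubst_powSubOne p ℤ_[p] b) (h := algebraMap ℤ_[p] O)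
    (PowerSeries.binomialSeries ℤ_[p] a)
  have h3 : MvPowerSeries.map (algebraMap ℤ_[p] O) (powSubOne p ℤ_[p] b) = powSubOne p O b := by
    change PowerSeries.map (algebraMap ℤ_[p] O) _ = _
    rw [powSubOne, map_sub, hm, map_one, powSubOne]
  rw [h3] at h2
  exact h2.symm

end Binomial

/-! ### Uniqueness of homomorphisms modulo a closed ideal. -/

section Uniqueness

variable {σ τ O O' D : Type*} [CommRing O] [CommRing O'] [CommRing D]

theorem mem_of_forall_mem_pow_sup (H J : Ideal D) [IsHausdorff J (D ⧸ H)] {x : D}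
    (hx : ∀ n : ℕ, x ∈ J ^ n ⊔ H) : x ∈ H := by
  rw [← Ideal.Quotient.eq_zero_iff_mem]
  refine IsHausdorff.haus (I := J) ‹_› _ fun n => ?_
  rw [SModEq.zero]
  obtain ⟨y, hy, z, hz, hyz⟩ := Submodule.mem_sup.mp (hx n)
  rw [← hyz, map_add, Ideal.Quotient.eq_zero_iff_mem.mpr hz, add_zero]
  have : (Ideal.Quotient.mk H y) = y • (1 : D ⧸ H) := by
    rw [Algebra.smul_def, mul_one]; rfl
  rw [this]
  exact Submodule.smul_mem_smul hy trivial

/-- Two ring homomorphisms on a power series ring that agree modulo an ideal `H` on constants and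
variables agree modulo `H`, provided `H` is closed for the topology of an ideal `J` that contains
the images of the variables. -/
theorem ringHom_sub_mem_of_isHausdorff [Finite σ] (H J : Ideal D) [IsHausdorff J (D ⧸ H)]
    {φ ψ : MvPowerSeries σ O →+* D} (hC : ∀ c, φ (C c) - ψ (C c) ∈ H)
    (hX : ∀ i, φ (X i) - ψ (X i) ∈ H) (hJ : ∀ i, φ (X i) ∈ J) (f : MvPowerSeries σ O) :
    φ f - ψ f ∈ H := by
  have := Fintype.ofFinite σ
  have key : ∀ n : ℕ, ∀ f, φ f - ψ f ∈ J ^ n ⊔ H := by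
    intro n
    induction n with
    | zero => simp
    | succ n ih =>
      intro f
      obtain ⟨g, hg⟩ := exists_eq_C_add_sum_X_mul f
      rw [hg]
      simp only [map_add, map_sum, map_mul]
      rw [add_sub_add_comm, ← Finset.sum_sub_distrib]
      refine Ideal.add_mem _ (Ideal.mem_sup_right (hC _)) (Ideal.sum_mem _ fun i _ => ?_)
      rw [show φ (X i) * φ (g i) - ψ (X i) * ψ (g i) = φ (X i) * (φ (g i) - ψ (g i)) +
        (φ (X i) - ψ (X i)) * ψ (g i) by ring]
      refine Ideal.add_mem _ ?_ (Ideal.mem_sup_right (Ideal.mul_mem_right _ _ (hX i)))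
      obtain ⟨y, hy, z, hz, hyz⟩ := Submodule.mem_sup.mp (ih (g i))
      rw [← hyz, mul_add, pow_succ']
      exact Ideal.add_mem _ (Ideal.mem_sup_left (Ideal.mul_mem_mul (hJ i) hy))
        (Ideal.mem_sup_right (Ideal.mul_mem_left _ _ hz))
  exact mem_of_forall_mem_pow_sup H J fun n => key n f

theorem ringHom_ext_of_constantCoeff [Finite σ] [Finite τ] [IsNoetherianRing O']
    {φ ψ : MvPowerSeries σ O →+* MvPowerSeries τ O'} (hC : ∀ c, φ (C c) = ψ (C c))
    (hX : ∀ i, φ (X i) = ψ (X i)) (h0 : ∀ i, constantCoeff (φ (X i)) = 0) : φ = ψ :=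
  ringHom_ext_of_isHausdorff (varsIdeal τ O') hC hX fun i => mem_varsIdeal.mpr (h0 i)

theorem algHom_ext_of_constantCoeff [Finite σ] [Finite τ] [IsNoetherianRing O]
    {φ ψ : MvPowerSeries σ O →ₐ[O] MvPowerSeries τ O}
    (hX : ∀ i, φ (X i) = ψ (X i)) (h0 : ∀ i, constantCoeff (φ (X i)) = 0) : φ = ψ := by
  refine AlgHom.coe_ringHom_injective (ringHom_ext_of_constantCoeff (fun c => ?_) hX h0)
  exact (φ.commutes c).trans (ψ.commutes c).symm

theorem algHom_C (φ : MvPowerSeries σ O →ₐ[O] MvPowerSeries τ O) (c : O) : φ (C c) = C c :=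
  φ.commutes c

theorem substAlgHom_X' {a : σ → MvPowerSeries τ O} (ha : HasSubst a) (i : σ) :
    substAlgHom (R := O) ha (X i) = a i := by
  rw [substAlgHom_apply, subst_X ha]

end Uniqueness

/-! ### Series in a subset of the variables, and expansion in one variable. -/

section SomeVariables

variable {σ O : Type*} [CommRing O] [Finite σ] [DecidableEq σ]

/-- The `O`-algebra endomorphism that sends the variables outside `s` to `0`. -/
def keepVars (O : Type*) [CommRing O] (s : Finset σ) :
    MvPowerSeries σ O →ₐ[O] MvPowerSeries σ O :=
  substAlgHom (a := fun i => if i ∈ s then X i else 0)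
    (hasSubst_of_constantCoeff_zero fun i => by split_ifs <;> simp)

theorem keepVars_X (s : Finset σ) (i : σ) :
    keepVars O s (X i) = if i ∈ s then X i else 0 := substAlgHom_X' _ i

variable [IsNoetherianRing O]

theorem keepVars_keepVars (s t : Finset σ) (f : MvPowerSeries σ O) :
    keepVars O s (keepVars O t f) = keepVars O (s ∩ t) f := by
  have : (keepVars O s).comp (keepVars O t) = keepVars O (s ∩ t) := by
    refine algHom_ext_of_constantCoeff (fun i => ?_) fun i => ?_
    · simp only [AlgHom.comp_apply, keepVars_X, Finset.mem_inter]
      by_cases hs : i ∈ s <;> by_cases ht : i ∈ t <;> simp [hs, ht, keepVars_X]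
    · simp only [AlgHom.comp_apply, keepVars_X]
      split_ifs
      · rw [keepVars_X]; split_ifs <;> simp
      · simp
  exact DFunLike.congr_fun this f

theorem keepVars_empty (f : MvPowerSeries σ O) :
    keepVars O ∅ f = C (constantCoeff f) := by
  have : (keepVars O ∅ : _ →ₐ[O] MvPowerSeries σ O).toRingHom = C.comp constantCoeff := by
    refine ringHom_ext_of_constantCoeff (fun c => ?_) (fun i => ?_) fun i => ?_
    · simp [algHom_C]
    · simp [keepVars_X]
    · simp [keepVars_X]
  exact DFunLike.congr_fun this f

/-- The identity and the map killing `X l` agree on constants and variables modulo the closed ideal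
`(X l)`, hence everywhere. -/
theorem X_dvd_sub_keepVars [Fintype σ] (l : σ) (f : MvPowerSeries σ O) :
    X l ∣ f - keepVars O (Finset.univ.erase l) f := by
  rw [← Ideal.mem_span_singleton]
  have : IsHausdorff (varsIdeal σ O) (MvPowerSeries σ O ⧸ Ideal.span {(X l : MvPowerSeries σ O)}) :=
    IsHausdorff.of_le_jacobson _ _ varsIdeal_le_jacobson
  refine ringHom_sub_mem_of_isHausdorff _ (varsIdeal σ O) (φ := RingHom.id _)
    (ψ := (keepVars O (Finset.univ.erase l)).toRingHom) (fun c => ?_) (fun i => ?_) (fun i => ?_) f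
  · simp [algHom_C]
  · rcases eq_or_ne i l with rfl | hi
    · simp [keepVars_X]
    · simp [keepVars_X, hi]
  · simp [mem_varsIdeal]

/-- A power series in the variables `s` is expanded in powers of one of these variables. Since the
ring is noetherian, the tail of the expansion lies in the ideal of the first coefficients. -/
theorem exists_expansion [IsDomain O] [Fintype σ] {s : Finset σ} {l : σ} (hl : l ∈ s)
    {f : MvPowerSeries σ O} (hf : keepVars O s f = f) :
    ∃ (U : ℕ) (c : ℕ → MvPowerSeries σ O) (h : MvPowerSeries σ O),
      (∀ u, keepVars O (s.erase l) (c u) = c u) ∧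
      f = ∑ u ∈ Finset.range (U + 1), c u * X l ^ u + X l ^ (U + 1) * h ∧
      h ∈ Ideal.span (c '' Set.Iic U) := by
  set κ := keepVars O (Finset.univ.erase l) with hκ
  have hdvd : ∀ g, ∃ g', g = κ g + X l * g' := fun g => by
    obtain ⟨g', hg'⟩ := X_dvd_sub_keepVars l g
    exact ⟨g', by rw [← hg', add_sub_cancel]⟩
  choose δ hδ using hdvd
  -- `G u` is the quotient after `u` divisions of `f` by `X l`; the `c u` below are the remainders,
  -- which do not involve `X l`.
  let G : ℕ → MvPowerSeries σ O := fun u => δ^[u] f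
  have hG0 : G 0 = f := rfl
  have hGs : ∀ u, G (u + 1) = δ (G u) := fun u => Function.iterate_succ_apply' δ u f
  have hGsupp : ∀ u, keepVars O s (G u) = G u := by
    intro u
    induction u with
    | zero => exact hf
    | succ u ih =>
      have h1 := hδ (G u)
      have h2 := congrArg (keepVars O s) h1
      rw [map_add, map_mul, keepVars_X, if_pos hl, ih, hκ, keepVars_keepVars, Finset.inter_comm,
        ← keepVars_keepVars, ih, ← hκ] at h2
      have h3 : X l * keepVars O s (δ (G u)) = X l * δ (G u) := by
        have := h2.symm.trans h1
        exact add_left_cancel this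
      rw [hGs]
      exact mul_left_cancel₀ (nonZeroDivisors.ne_zero (X_mem_nonzeroDivisors (i := l))) h3
  let c : ℕ → MvPowerSeries σ O := fun u => κ (G u)
  have hexp : ∀ v r, G v = ∑ u ∈ Finset.range r, c (v + u) * X l ^ u + X l ^ r * G (v + r) := by
    intro v r
    induction r with
    | zero => simp
    | succ r ih =>
      rw [Finset.sum_range_succ, ih, ← add_assoc v r 1, hGs]
      linear_combination X l ^ r * hδ (G (v + r))
  have hall : ∀ v, G v ∈ Ideal.span (Set.range c) := by
    intro v
    have : IsHausdorff (varsIdeal σ O) (MvPowerSeries σ O ⧸ Ideal.span (Set.range c)) :=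
      IsHausdorff.of_le_jacobson _ _ varsIdeal_le_jacobson
    refine mem_of_forall_mem_pow_sup _ (varsIdeal σ O) fun n => ?_
    rw [hexp v n]
    refine Ideal.add_mem _ (Ideal.mem_sup_right (Ideal.sum_mem _ fun u _ =>
      Ideal.mul_mem_right _ _ (Ideal.subset_span ⟨_, rfl⟩)))
      (Ideal.mem_sup_left (Ideal.mul_mem_right _ _ (Ideal.pow_mem_pow ?_ n)))
    simp [mem_varsIdeal]
  -- The tail lies in the ideal of all the `c u`, and by the ascending chain condition `c 0, …, c U`
  -- generate it for some `U`.
  obtain ⟨U, hU⟩ := monotone_stabilizes_iff_noetherian.mpr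
    (inferInstance : IsNoetherianRing (MvPowerSeries σ O))
    ⟨fun U => Ideal.span (c '' Set.Iic U), fun a b hab => Ideal.span_mono
      (Set.image_mono (Set.Iic_subset_Iic.mpr hab))⟩
  refine ⟨U, c, G (U + 1), fun u => ?_, ?_, ?_⟩
  · have h1 : c u = keepVars O (Finset.univ.erase l ∩ s) (G u) := by
      rw [← keepVars_keepVars, hGsupp]
    have h2 : s.erase l ∩ (Finset.univ.erase l ∩ s) = Finset.univ.erase l ∩ s := by
      ext i
      simp only [Finset.mem_inter, Finset.mem_erase, Finset.mem_univ]
      tauto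
    rw [h1, keepVars_keepVars, h2]
  · have h1 := hexp 0 (U + 1)
    simp_rw [Nat.zero_add] at h1
    exact h1
  · refine (Ideal.span_le.mpr ?_) (hall (U + 1))
    rintro _ ⟨u, rfl⟩
    have h1 : c u ∈ Ideal.span (c '' Set.Iic (max U u)) :=
      Ideal.subset_span ⟨u, Set.mem_Iic.mpr (le_max_right _ _), rfl⟩
    have h2 := hU (max U u) (le_max_left _ _)
    exact h2.symm.le h1

end SomeVariables

/-! ### Restriction to the curves `X_i = (1 + T) ^ (a i) - 1`. -/

section Curve

variable (p : ℕ) [Fact p.Prime] (O : Type*) [CommRing O] [Algebra ℤ_[p] O] {σ : Type*} [Finite σ]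

/-- The restriction of power series to the curve `X_i = (1 + T) ^ (a i) - 1`. -/
def curve (a : σ → ℤ_[p]) : MvPowerSeries σ O →ₐ[O] MvPowerSeries Unit O :=
  substAlgHom (a := fun i => (powSubOne p O (a i) : MvPowerSeries Unit O))
    (hasSubst_of_constantCoeff_zero fun i => constantCoeff_powSubOne p O (a i))

variable {p O}

theorem curve_X (a : σ → ℤ_[p]) (i : σ) : curve p O a (X i) = powSubOne p O (a i) :=
  substAlgHom_X' _ i

theorem constantCoeff_curve_X (a : σ → ℤ_[p]) (i : σ) :
    constantCoeff (curve p O a (X i)) = 0 := by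
  rw [curve_X]
  exact constantCoeff_powSubOne p O (a i)

variable [IsNoetherianRing O]

theorem algHom_onePlusXPow {n : ℕ} {τ : Type*} [Finite τ]
    (φ : MvPowerSeries (Fin n) O →ₐ[O] MvPowerSeries τ O) (j : Fin n)
    (h0 : constantCoeff (φ (X j)) = 0) (α : ℤ_[p]) :
    φ (onePlusXPow p O j α) = (PowerSeries.binomialSeries O α).subst (φ (X j)) := by
  have hs : PowerSeries.HasSubst (φ (X j)) := PowerSeries.HasSubst.of_constantCoeff_zero h0
  have hX : PowerSeries.HasSubst (X j : MvPowerSeries (Fin n) O) := PowerSeries.HasSubst.X j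
  have : (φ.comp (PowerSeries.substAlgHom hX)) = PowerSeries.substAlgHom hs := by
    refine algHom_ext_of_constantCoeff (σ := Unit) (fun i => ?_) fun i => ?_
    · change φ (PowerSeries.substAlgHom hX PowerSeries.X) =
        PowerSeries.substAlgHom hs PowerSeries.X
      rw [PowerSeries.substAlgHom_X, PowerSeries.substAlgHom_X]
    · change constantCoeff (φ (PowerSeries.substAlgHom hX PowerSeries.X)) = 0
      rw [PowerSeries.substAlgHom_X, h0]
  have h := DFunLike.congr_fun this (PowerSeries.binomialSeries O α)
  rwa [AlgHom.comp_apply, PowerSeries.coe_substAlgHom, PowerSeries.coe_substAlgHom] at h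

theorem curve_onePlusXPow {n : ℕ} (a : Fin n → ℤ_[p]) (j : Fin n) (α : ℤ_[p]) :
    curve p O a (onePlusXPow p O j α) = PowerSeries.binomialSeries O (α * a j) := by
  rw [algHom_onePlusXPow _ _ (constantCoeff_curve_X a j), curve_X]
  exact subst_binomialSeries p O α (a j)

theorem curve_keepVars [DecidableEq σ] (s : Finset σ) {a b : σ → ℤ_[p]}
    (hab : ∀ i ∈ s, a i = b i) (f : MvPowerSeries σ O) :
    curve p O a (keepVars O s f) = curve p O b (keepVars O s f) := by
  have : (curve p O a).comp (keepVars O s) = (curve p O b).comp (keepVars O s) := by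
    refine algHom_ext_of_constantCoeff (fun i => ?_) fun i => ?_
    · simp only [AlgHom.comp_apply, keepVars_X]
      split_ifs with hi
      · rw [curve_X, curve_X, hab i hi]
      · simp
    · simp only [AlgHom.comp_apply, keepVars_X]
      split_ifs with hi
      · exact constantCoeff_curve_X a i
      · simp
  exact DFunLike.congr_fun this f

end Curve

/-! ### Orders of vanishing over a field. -/

section Order

variable {k : Type*} [Field k]

theorem X_pow_dvd_iff_le_order (m : ℕ) (φ : PowerSeries k) :
    PowerSeries.X ^ m ∣ φ ↔ (m : ℕ∞) ≤ φ.order := by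
  rw [PowerSeries.order_eq_emultiplicity_X, pow_dvd_iff_le_emultiplicity]

/-- A lower bound for the order of `∑ c u * x ^ u + x ^ (U + 1) * h` gives lower bounds for the
orders of the `c u` if these orders are divisible by a large number. -/
theorem X_pow_dvd_of_dvd_sum {U q Q P : ℕ} {c : ℕ → PowerSeries k} {x h : PowerSeries k}
    (hx : x.order = q) (hq : 0 < q) (hQ : U * q < Q) (hQP : Q ∣ P)
    (hc : ∀ u ≤ U, ∃ γ, c u = γ ^ Q) (hh : h ∈ Ideal.span (c '' Set.Iic U))
    (hdvd : PowerSeries.X ^ P ∣ ∑ u ∈ Finset.range (U + 1), c u * x ^ u + x ^ (U + 1) * h) :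
    ∀ u ≤ U, PowerSeries.X ^ P ∣ c u := by
  classical
  by_contra! hcon
  obtain ⟨u₀, hu₀, hu₀P⟩ := hcon
  -- Among the indices where `c u` has minimal order, the least one, `u₁`, is used; its term
  -- dominates the sum.
  have hex : ∃ u, u ≤ U ∧ ∀ v ≤ U, (c u).order ≤ (c v).order := by
    obtain ⟨u, hu, hmin⟩ := Finset.exists_min_image (Finset.range (U + 1))
      (fun u => (c u).order) ⟨0, by simp⟩
    exact ⟨u, by simpa [Nat.lt_succ_iff] using hu,
      fun v hv => hmin v (by simpa [Nat.lt_succ_iff] using hv)⟩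
  obtain ⟨hu₁, hmin⟩ := Nat.find_spec hex
  have hleast : ∀ v < Nat.find hex, (c (Nat.find hex)).order < (c v).order := by
    intro v hv
    have h1 := Nat.find_min hex hv
    by_contra! h2
    exact h1 ⟨hv.le.trans hu₁, fun w hw => h2.trans (hmin w hw)⟩
  set u₁ := Nat.find hex
  rw [X_pow_dvd_iff_le_order, not_le] at hu₀P
  have hlt : (c u₁).order < P := (hmin u₀ hu₀).trans_lt hu₀P
  have hordQ : ∀ u ≤ U, ∀ m : ℕ, (c u).order = m → Q ∣ m := by
    intro u hu m hm
    obtain ⟨γ, hγ⟩ := hc u hu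
    rw [hγ, PowerSeries.order_pow] at hm
    rcases eq_or_ne Q 0 with rfl | hQ0
    · simp at hQ
    · have hγ' : γ.order ≠ ⊤ := by
        intro htop
        rw [htop, nsmul_eq_mul, ENat.mul_top (by exact_mod_cast hQ0)] at hm
        exact ENat.top_ne_natCast _ hm
      obtain ⟨g, hg⟩ := ENat.ne_top_iff_exists.mp hγ'
      rw [← hg, nsmul_eq_mul] at hm
      exact ⟨g, by exact_mod_cast hm.symm⟩
  obtain ⟨e, he⟩ := ENat.ne_top_iff_exists.mp (ne_top_of_lt hlt)
  rw [← he] at hlt hmin hleast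
  obtain ⟨e', rfl⟩ := hordQ u₁ hu₁ e he.symm
  obtain ⟨P', rfl⟩ := hQP
  have heP : Q * e' < Q * P' := by exact_mod_cast hlt
  have heP' : Q * e' + Q ≤ Q * P' := by
    have := Nat.lt_of_mul_lt_mul_left heP
    calc Q * e' + Q = Q * (e' + 1) := by ring
      _ ≤ Q * P' := Nat.mul_le_mul_left _ this
  -- Finite orders of the `c v` are multiples of `Q`, so an order above `Q * e'` is at least `Q * e'
  -- + Q`.
  have hgap : ∀ v < u₁, ((Q * e' + Q : ℕ) : ℕ∞) ≤ (c v).order := by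
    intro v hv
    have h1 := hleast v hv
    rcases eq_or_ne (c v).order ⊤ with h2 | h2
    · rw [h2]; exact le_top
    · obtain ⟨m, hm⟩ := ENat.ne_top_iff_exists.mp h2
      rw [← hm] at h1 ⊢
      obtain ⟨m', rfl⟩ := hordQ v (hv.le.trans hu₁) m hm.symm
      have h3 : Q * e' < Q * m' := by exact_mod_cast h1
      have h4 := Nat.lt_of_mul_lt_mul_left h3
      have : Q * e' + Q ≤ Q * m' := by
        calc Q * e' + Q = Q * (e' + 1) := by ring
          _ ≤ Q * m' := Nat.mul_le_mul_left _ h4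
      exact_mod_cast this
  have hxord : ∀ u : ℕ, (x ^ u).order = (u * q : ℕ) := by
    intro u
    rw [PowerSeries.order_pow, hx, nsmul_eq_mul]
    push_cast
    rfl
  -- `d` is the order of the term of index `u₁`. Earlier terms have larger order because of the gap
  -- `Q > U * q`, later ones and the tail because of the additional factors `x`.
  set d := Q * e' + u₁ * q with hd
  have hdQ : d + 1 ≤ Q * e' + Q := by
    have : u₁ * q ≤ U * q := Nat.mul_le_mul_right _ hu₁
    omega
  have hother : ∀ u ∈ Finset.range (U + 1), u ≠ u₁ →
      (PowerSeries.X : PowerSeries k) ^ (d + 1) ∣ c u * x ^ u := by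
    intro u hu hne
    rcases lt_or_gt_of_ne hne with hlt' | hgt
    · refine Dvd.dvd.mul_right ?_ _
      rw [X_pow_dvd_iff_le_order]
      exact le_trans (by exact_mod_cast hdQ) (hgap u hlt')
    · rw [X_pow_dvd_iff_le_order, PowerSeries.order_mul, hxord]
      have h1 := hmin u (Nat.lt_succ_iff.mp (Finset.mem_range.mp hu))
      have h2 : d + 1 ≤ Q * e' + u * q := by
        have : (u₁ + 1) * q ≤ u * q := Nat.mul_le_mul_right _ hgt
        rw [add_mul, one_mul] at this
        omega
      calc ((d + 1 : ℕ) : ℕ∞) ≤ ((Q * e' + u * q : ℕ) : ℕ∞) := by exact_mod_cast h2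
        _ = ((Q * e' : ℕ) : ℕ∞) + ((u * q : ℕ) : ℕ∞) := by push_cast; rfl
        _ ≤ _ := add_le_add_left h1 _
  have htail : (PowerSeries.X : PowerSeries k) ^ (d + 1) ∣ x ^ (U + 1) * h := by
    have h1 : PowerSeries.X ^ (Q * e') ∣ h := by
      rw [← Ideal.mem_span_singleton]
      refine (Ideal.span_le.mpr ?_) hh
      rintro _ ⟨u, hu, rfl⟩
      rw [SetLike.mem_coe, Ideal.mem_span_singleton, X_pow_dvd_iff_le_order]
      exact hmin u hu
    have h2 : (PowerSeries.X : PowerSeries k) ^ ((U + 1) * q) ∣ x ^ (U + 1) := by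
      rw [X_pow_dvd_iff_le_order, hxord]
    refine (pow_dvd_pow _ ?_).trans (pow_add (PowerSeries.X : PowerSeries k) _ _ ▸
      mul_dvd_mul h2 h1)
    have : (u₁ + 1) * q ≤ (U + 1) * q := Nat.mul_le_mul_right _ (by omega)
    rw [add_mul, one_mul] at this
    omega
  have hmain : (PowerSeries.X : PowerSeries k) ^ (d + 1) ∣ c u₁ * x ^ u₁ := by
    have h1 := (pow_dvd_pow PowerSeries.X (hdQ.trans heP')).trans hdvd
    rw [← Finset.add_sum_erase _ _ (Finset.mem_range.mpr (Nat.lt_succ_iff.mpr hu₁)),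
      add_assoc (c u₁ * x ^ u₁)] at h1
    refine (dvd_add_left (dvd_add (Finset.dvd_sum fun u hu => ?_) htail)).mp h1
    exact hother u (Finset.mem_of_mem_erase hu) (Finset.ne_of_mem_erase hu)
  rw [X_pow_dvd_iff_le_order, PowerSeries.order_mul, hxord, ← he] at hmain
  have : d + 1 ≤ Q * e' + u₁ * q := by exact_mod_cast hmain
  omega

end Order

/-! ### Frobenius and the curves over `𝔽_p`. -/

section CharP

variable (p : ℕ) [Fact p.Prime]

instance charP_mvPowerSeries (σ : Type*) : CharP (MvPowerSeries σ (ZMod p)) p :=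
  charP_of_injective_ringHom (f := (C : ZMod p →+* MvPowerSeries σ (ZMod p))) (C_injective) p

theorem binomialSeries_natCast_mul (O : Type*) [CommRing O] [Algebra ℤ_[p] O] (m : ℕ)
    (b : ℤ_[p]) : PowerSeries.binomialSeries O ((m : ℤ_[p]) * b) =
      PowerSeries.binomialSeries O b ^ m := by
  induction m with
  | zero => simp
  | succ m ih => rw [Nat.cast_succ, add_mul, one_mul, PowerSeries.binomialSeries_add, ih, pow_succ]

variable [Algebra ℤ_[p] (ZMod p)]

theorem powSubOne_pow_mul (j : ℕ) (b : ℤ_[p]) :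
    powSubOne p (ZMod p) ((p : ℤ_[p]) ^ j * b) = powSubOne p (ZMod p) b ^ p ^ j := by
  have h := binomialSeries_natCast_mul p (ZMod p) (p ^ j) b
  rw [Nat.cast_pow] at h
  rw [powSubOne, powSubOne, h]
  have := charP_mvPowerSeries p Unit
  rw [sub_pow_char_pow, one_pow]

theorem order_powSubOne_unit {u : ℤ_[p]} (hu : IsUnit u) :
    (powSubOne p (ZMod p) u).order = 1 := by
  refine PowerSeries.order_eq_nat.mpr ⟨?_, fun i hi => ?_⟩
  · simp only [powSubOne, map_sub, PowerSeries.binomialSeries_coeff, Ring.choose_one_right,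
      PowerSeries.coeff_one, one_ne_zero, if_false, sub_zero]
    rw [Algebra.smul_def, mul_one]
    exact (hu.map _).ne_zero
  · obtain rfl : i = 0 := by omega
    simpa using constantCoeff_powSubOne p (ZMod p) u

theorem order_powSubOne (i : ℕ) {u : ℤ_[p]} (hu : IsUnit u) :
    (powSubOne p (ZMod p) ((p : ℤ_[p]) ^ i * u)).order = (p ^ i : ℕ) := by
  rw [powSubOne_pow_mul, PowerSeries.order_pow, order_powSubOne_unit p hu, nsmul_eq_mul, mul_one]

/-- Iterated Frobenius is a ring homomorphism that fixes the constants in `𝔽_p` and sends `(1 + T) ^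
b - 1` to `(1 + T) ^ (p ^ j * b) - 1`. -/
theorem curve_pow_mul {σ : Type*} [Finite σ] (j : ℕ) (b : σ → ℤ_[p])
    (f : MvPowerSeries σ (ZMod p)) :
    curve p (ZMod p) (fun i => (p : ℤ_[p]) ^ j * b i) f = curve p (ZMod p) b f ^ p ^ j := by
  have := charP_mvPowerSeries p Unit
  have : ExpChar (MvPowerSeries Unit (ZMod p)) p := ExpChar.prime Fact.out
  have h : (curve p (ZMod p) (fun i => (p : ℤ_[p]) ^ j * b i)).toRingHom =
      (iterateFrobenius (MvPowerSeries Unit (ZMod p)) p j).comp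
        (curve p (ZMod p) b).toRingHom := by
    refine ringHom_ext_of_constantCoeff (fun c => ?_) (fun i => ?_) fun i => ?_
    · simp only [AlgHom.toRingHom_eq_coe, RingHom.coe_coe, RingHom.comp_apply, algHom_C,
        iterateFrobenius_def]
      rw [← map_pow, ZMod.pow_card_pow]
    · simp only [AlgHom.toRingHom_eq_coe, RingHom.coe_coe, RingHom.comp_apply, curve_X,
        iterateFrobenius_def]
      exact powSubOne_pow_mul p j (b i)
    · exact constantCoeff_curve_X _ i
  have h2 := DFunLike.congr_fun h f
  simpa [iterateFrobenius_def] using h2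

end CharP

/-! ### Shears along one variable. -/

section Shear

variable (p : ℕ) [Fact p.Prime] (O : Type*) [CommRing O] [Algebra ℤ_[p] O] {n : ℕ}

/-- The substitution `X_m ↦ (1 + X_m) (1 + X_l) ^ (α m) - 1`. -/
def shear (l : Fin n) (α : Fin n → ℤ_[p]) :
    MvPowerSeries (Fin n) O →ₐ[O] MvPowerSeries (Fin n) O :=
  substAlgHom (a := fun m => (1 + X m) * onePlusXPow p O l (α m) - 1)
    (hasSubst_of_constantCoeff_zero fun m => by simp [constantCoeff_onePlusXPow])

theorem shear_X (l : Fin n) (α : Fin n → ℤ_[p]) (m : Fin n) :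
    shear p O l α (X m) = (1 + X m) * onePlusXPow p O l (α m) - 1 := substAlgHom_X' _ m

theorem onePlusXPow_zero (l : Fin n) : onePlusXPow p O l 0 = 1 := by
  rw [onePlusXPow, PowerSeries.binomialSeries_zero,
    ← PowerSeries.coe_substAlgHom (PowerSeries.HasSubst.X l), map_one]

theorem onePlusXPow_add (l : Fin n) (a b : ℤ_[p]) :
    onePlusXPow p O l (a + b) = onePlusXPow p O l a * onePlusXPow p O l b := by
  rw [onePlusXPow, PowerSeries.binomialSeries_add, PowerSeries.subst_mul (PowerSeries.HasSubst.X l)]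
  rfl

variable {p O} [IsNoetherianRing O]

theorem map_onePlusXPow_of_map_X {τ : Type*} [Finite τ]
    {φ ψ : MvPowerSeries (Fin n) O →ₐ[O] MvPowerSeries τ O} {j : Fin n}
    (h0 : constantCoeff (φ (X j)) = 0) (h : φ (X j) = ψ (X j)) (α : ℤ_[p]) :
    φ (onePlusXPow p O j α) = ψ (onePlusXPow p O j α) := by
  rw [algHom_onePlusXPow φ j h0, algHom_onePlusXPow ψ j (h ▸ h0), h]

/-- Because `α l = 0`, the variable `X l` is fixed and the factors `(1 + X l) ^ (α m)` cancel. -/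
theorem shear_shear_neg {l : Fin n} {α : Fin n → ℤ_[p]} (hα : α l = 0)
    (f : MvPowerSeries (Fin n) O) : shear p O l (-α) (shear p O l α f) = f := by
  have hl : shear p O l (-α) (X l) = X l := by
    rw [shear_X, Pi.neg_apply, hα, neg_zero, onePlusXPow_zero]; ring
  have : (shear p O l (-α)).comp (shear p O l α) = AlgHom.id O _ := by
    have hX : ∀ i, (shear p O l (-α)).comp (shear p O l α) (X i) = X i := by
      intro i
      have h1 : shear p O l (-α) (onePlusXPow p O l (α i)) = onePlusXPow p O l (α i) :=
        map_onePlusXPow_of_map_X (ψ := AlgHom.id O _) (by simp [hl]) hl _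
      rw [AlgHom.comp_apply, shear_X, map_sub, map_mul, map_add, map_one, h1, shear_X,
        add_sub_cancel, mul_assoc, ← onePlusXPow_add, Pi.neg_apply, neg_add_cancel,
        onePlusXPow_zero]
      ring
    exact algHom_ext_of_constantCoeff (fun i => hX i) fun i => by rw [hX]; simp
  exact DFunLike.congr_fun this f

theorem curve_shear (l : Fin n) (α a : Fin n → ℤ_[p]) (f : MvPowerSeries (Fin n) O) :
    curve p O a (shear p O l α f) = curve p O (fun m => a m + α m * a l) f := by
  have : (curve p O a).comp (shear p O l α) = curve p O (fun m => a m + α m * a l) := by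
    have hX : ∀ i, (curve p O a).comp (shear p O l α) (X i) = powSubOne p O (a i + α i * a l) := by
      intro i
      rw [AlgHom.comp_apply, shear_X, map_sub, map_mul, map_add, map_one, curve_X,
        curve_onePlusXPow, powSubOne, powSubOne, add_sub_cancel, PowerSeries.binomialSeries_add]
    refine algHom_ext_of_constantCoeff (fun i => ?_) fun i => ?_
    · rw [hX, curve_X]
    · rw [hX]
      exact constantCoeff_powSubOne p O _
  exact DFunLike.congr_fun this f

theorem keepVars_shear {s : Finset (Fin n)} {l : Fin n} (hl : l ∈ s) {α : Fin n → ℤ_[p]}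
    {f : MvPowerSeries (Fin n) O} (hf : keepVars O s f = f) :
    keepVars O s (shear p O l α f) = shear p O l α f := by
  have hpow : ∀ b, keepVars O s (onePlusXPow p O l b) = onePlusXPow p O l b := fun b =>
    map_onePlusXPow_of_map_X (ψ := AlgHom.id O _) (by simp [keepVars_X, hl])
      (by simp [keepVars_X, hl]) b
  have hX : ∀ i, keepVars O s (shear p O l α (keepVars O s (X i))) =
      shear p O l α (keepVars O s (X i)) := by
    intro i
    rw [keepVars_X]
    split_ifs with hi
    · rw [shear_X, map_sub, map_mul, map_add, map_one, hpow, keepVars_X, if_pos hi]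
    · simp
  have : (keepVars O s).comp ((shear p O l α).comp (keepVars O s)) =
      (shear p O l α).comp (keepVars O s) := by
    refine algHom_ext_of_constantCoeff hX fun i => ?_
    rw [AlgHom.comp_apply, AlgHom.comp_apply, hX, keepVars_X]
    split_ifs
    · rw [shear_X]; simp [constantCoeff_onePlusXPow]
    · simp
  have h := DFunLike.congr_fun this f
  simpa only [AlgHom.comp_apply, hf] using h

end Shear

/-! ### Divisibility in `ℤ_p` and limits along ultrafilters. -/

section Padic

variable {p : ℕ} [Fact p.Prime]

theorem padicInt_dvd_of_norm_le {x y : ℤ_[p]} (h : ‖y‖ ≤ ‖x‖) : x ∣ y := by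
  rcases eq_or_ne x 0 with rfl | hx
  · rw [norm_zero, norm_le_zero_iff] at h
    rw [h]
  · rw [PadicInt.unitCoeff_spec hx, (PadicInt.unitCoeff hx).isUnit.mul_left_dvd,
      ← Ideal.mem_span_singleton, ← PadicInt.norm_le_pow_iff_mem_span_pow,
      ← PadicInt.norm_eq_zpow_neg_valuation hx]
    exact h

theorem exists_forall_dvd {σ : Type*} {s : Finset σ} (hs : s.Nonempty) (a : σ → ℤ_[p]) :
    ∃ l ∈ s, ∀ m ∈ s, a l ∣ a m := by
  obtain ⟨l, hl, hmax⟩ := s.exists_max_image (fun i => ‖a i‖) hs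
  exact ⟨l, hl, fun m hm => padicInt_dvd_of_norm_le (hmax m hm)⟩

/-- Along an ultrafilter, a family of `p`-adic integers becomes constant modulo each power of
`p`. -/
theorem exists_forall_eventually_pow_dvd_sub {Ω : Type*} (𝒰 : Ultrafilter Ω) (q : Ω → ℤ_[p]) :
    ∃ α : ℤ_[p], ∀ J : ℕ, ∀ᶠ ω in (𝒰 : Filter Ω), (p : ℤ_[p]) ^ J ∣ q ω - α := by
  refine ⟨(𝒰.map q).lim, fun J => ?_⟩
  have h := (𝒰.map q).le_nhds_lim (Metric.ball_mem_nhds _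
    (zpow_pos (by exact_mod_cast (Fact.out : p.Prime).pos) (-(J : ℤ)) :
      (0 : ℝ) < (p : ℝ) ^ (-(J : ℤ))))
  filter_upwards [h] with ω hω
  rw [← Ideal.mem_span_singleton, ← PadicInt.norm_le_pow_iff_mem_span_pow]
  exact (mem_ball_iff_norm.mp hω).le

theorem eventually_exists_mem_finset {Ω σ : Type*} (𝒰 : Ultrafilter Ω) (s : Finset σ)
    {P : σ → Ω → Prop} (h : ∀ᶠ ω in (𝒰 : Filter Ω), ∃ l ∈ s, P l ω) :
    ∃ l ∈ s, ∀ᶠ ω in (𝒰 : Filter Ω), P l ω := by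
  refine (Ultrafilter.finite_biUnion_mem_iff (is := (s : Set σ)) (s := fun l => {ω | P l ω})
    s.finite_toSet).mp ?_
  filter_upwards [h] with ω hω
  simpa using hω

end Padic

/-! ### Rigidity modulo `p`. -/

section Restriction

variable (p : ℕ) [Fact p.Prime] [Algebra ℤ_[p] (ZMod p)]

/-- Nonzero power series over `𝔽_p` restricted to a family of curves `X_i = (1 + T) ^ (a i) - 1`.
If no fixed relation between the `a i` holds modulo `p ^ N` along the ultrafilter, then the
restrictions do not vanish modulo `T ^ (p ^ N)`. -/
theorem eventually_not_X_pow_dvd_curve {Ω : Type*} (𝒰 : Ultrafilter Ω) (N : Ω → ℕ) {n : ℕ}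
    (s : Finset (Fin n)) : ∀ (a : Ω → Fin n → ℤ_[p]),
    (∀ τ : Fin n → ℤ_[p], (∃ i ∈ s, τ i ≠ 0) →
      ∀ᶠ ω in (𝒰 : Filter Ω), ¬ (p : ℤ_[p]) ^ N ω ∣ ∑ i ∈ s, τ i * a ω i) →
    ∀ f : MvPowerSeries (Fin n) (ZMod p), f ≠ 0 → keepVars (ZMod p) s f = f →
    ∀ᶠ ω in (𝒰 : Filter Ω),
      ¬ (PowerSeries.X : PowerSeries (ZMod p)) ^ p ^ N ω ∣ curve p (ZMod p) (a ω) f := by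
  have hp : p.Prime := Fact.out
  induction s using Finset.strongInduction with
  | H s ih =>
  intro a hgen f hf0 hf
  rcases s.eq_empty_or_nonempty with rfl | hs
  · refine Filter.Eventually.of_forall fun ω hdvd => hf0 ?_
    rw [keepVars_empty] at hf
    rw [← hf, algHom_C] at hdvd
    have h0 : PowerSeries.constantCoeff (C (constantCoeff f) : MvPowerSeries Unit (ZMod p)) = 0 :=
      PowerSeries.X_dvd_iff.mp ((dvd_pow_self _ (pow_ne_zero _ hp.ne_zero)).trans hdvd)
    have h1 : constantCoeff f = 0 := by
      rw [← h0]; exact (constantCoeff_C _).symm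
    rw [← hf, h1, map_zero]
  obtain ⟨l, hl, hdiv⟩ := eventually_exists_mem_finset 𝒰 s
    (Filter.Eventually.of_forall fun ω => exists_forall_dvd hs (a ω))
  have hq : ∀ ω, ∃ q : Fin n → ℤ_[p],
      (∀ m ∈ s, a ω l ∣ a ω m) → ∀ m ∈ s, a ω m = a ω l * q m := by
    intro ω
    by_cases h : ∀ m ∈ s, a ω l ∣ a ω m
    · choose! q hq using h
      exact ⟨q, fun _ => hq⟩
    · exact ⟨0, fun h' => absurd h' h⟩
  choose q hq using hq
  choose α₀ hα₀ using fun m => exists_forall_eventually_pow_dvd_sub 𝒰 fun ω => q ω m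
  -- The ratio at `l` has limit `1`, but `α l` must be `0` for the shear to be invertible and to
  -- preserve `a l`.
  let α : Fin n → ℤ_[p] := fun m => if m = l then 0 else α₀ m
  have hαl : α l = 0 := if_pos rfl
  have hαm : ∀ m, m ≠ l → α m = α₀ m := fun m hm => if_neg hm
  set g := shear p (ZMod p) l α f with hg
  have hg0 : g ≠ 0 := by
    intro h
    apply hf0
    rw [← shear_shear_neg hαl f, ← hg, h, map_zero]
  have hgs : keepVars (ZMod p) s g = g := keepVars_shear hl hf
  obtain ⟨U, c, h, hc, hexp, hh⟩ := exists_expansion hl hgs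
  obtain ⟨u₀, hu₀, hcu₀⟩ : ∃ u ≤ U, c u ≠ 0 := by
    by_contra! hcon
    apply hg0
    have hspan : Ideal.span (c '' Set.Iic U) = ⊥ := by
      rw [Ideal.span_eq_bot]
      rintro _ ⟨u, hu, rfl⟩
      exact hcon u hu
    rw [hspan, Ideal.mem_bot] at hh
    rw [hexp, hh, mul_zero, add_zero]
    exact Finset.sum_eq_zero fun u hu => by
      rw [hcon u (Nat.lt_succ_iff.mp (Finset.mem_range.mp hu)), zero_mul]
  let a' : Ω → Fin n → ℤ_[p] := fun ω m => a ω m - α m * a ω l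
  have ha'l : ∀ ω, a' ω l = a ω l := fun ω => by simp [a', hαl]
  have hcurve : ∀ ω, curve p (ZMod p) (a ω) f = curve p (ZMod p) (a' ω) g := by
    intro ω
    rw [hg, curve_shear]
    congr 2
    funext m
    rw [ha'l]
    simp [a']
  -- A relation among the `a' m` is a relation among the `a m` whose coefficient at `l` is `-∑ τ m *
  -- α m`.
  have hgen' : ∀ τ : Fin n → ℤ_[p], (∃ i ∈ s.erase l, τ i ≠ 0) →
      ∀ᶠ ω in (𝒰 : Filter Ω), ¬ (p : ℤ_[p]) ^ N ω ∣ ∑ i ∈ s.erase l, τ i * a' ω i := by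
    rintro τ ⟨i, hi, hτi⟩
    have := hgen (Function.update τ l (-∑ m ∈ s.erase l, τ m * α m))
      ⟨i, Finset.mem_of_mem_erase hi, by
        rwa [Function.update_of_ne (Finset.ne_of_mem_erase hi)]⟩
    filter_upwards [this] with ω hω
    convert! hω using 2
    rw [← Finset.add_sum_erase _ _ hl, Function.update_self, neg_mul, Finset.sum_mul,
      ← Finset.sum_neg_distrib, ← Finset.sum_add_distrib]
    refine Finset.sum_congr rfl fun m hm => ?_
    rw [Function.update_of_ne (Finset.ne_of_mem_erase hm)]
    ring
  have hIH := ih (s.erase l) (Finset.erase_ssubset hl) a' hgen' (c u₀) hcu₀ (hc u₀)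
  -- With this `J`, the order `U * p ^ i` of `X l ^ U` on the curve stays below the spacing `p ^ (i
  -- + J)` of the orders of the coefficients.
  obtain ⟨J, hJ⟩ : ∃ J, U < p ^ J := ⟨U, Nat.lt_pow_self hp.one_lt⟩
  have hαJ : ∀ᶠ ω in (𝒰 : Filter Ω), ∀ m, (p : ℤ_[p]) ^ J ∣ q ω m - α₀ m :=
    Filter.eventually_all.mpr fun m => hα₀ m J
  -- Genericity applied to `p ^ J * a l` gives `a l ≠ 0` and `i + J ≤ N`.
  have hlarge := hgen (Pi.single l ((p : ℤ_[p]) ^ J)) ⟨l, hl, by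
    simpa using fun h => absurd h hp.ne_zero⟩
  filter_upwards [hIH, hαJ, hlarge, hdiv] with ω h1 h2 h3 h4 h5
  rw [Finset.sum_eq_single_of_mem l hl fun m _ hm => by simp [hm], Pi.single_eq_same] at h3
  have hal : a ω l ≠ 0 := fun h => h3 (by rw [h, mul_zero]; exact dvd_zero _)
  obtain ⟨i, u, hu, hiu⟩ : ∃ (i : ℕ) (u : ℤ_[p]), IsUnit u ∧ a ω l = (p : ℤ_[p]) ^ i * u :=
    ⟨_, _, (PadicInt.unitCoeff hal).isUnit, by rw [mul_comm]; exact PadicInt.unitCoeff_spec hal⟩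
  have hiJ : i + J ≤ N ω := by
    by_contra! hcon
    apply h3
    rw [hiu, ← mul_assoc, ← pow_add]
    exact (pow_dvd_pow _ (by omega)).mul_right _
  -- `a' m = a l * (q m - α m)`: the first factor has valuation `i`, the second is divisible by `p ^
  -- J`.
  have hb : ∀ m, ∃ b, m ∈ s.erase l → a' ω m = (p : ℤ_[p]) ^ (i + J) * b := by
    intro m
    by_cases hm : m ∈ s.erase l
    · obtain ⟨b, hb⟩ := h2 m
      refine ⟨u * b, fun _ => ?_⟩
      simp only [a']
      rw [hαm m (Finset.ne_of_mem_erase hm), hq ω h4 m (Finset.mem_of_mem_erase hm), pow_add]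
      rw [show a ω l * q ω m - α₀ m * a ω l = a ω l * (q ω m - α₀ m) by ring, hb, hiu]
      ring
    · exact ⟨0, fun h => absurd h hm⟩
  choose b hb using hb
  have hpow : ∀ u, curve p (ZMod p) (a' ω) (c u) = curve p (ZMod p) b (c u) ^ p ^ (i + J) := by
    intro u
    rw [← curve_pow_mul, ← hc u]
    exact curve_keepVars _ hb _
  refine h1 (X_pow_dvd_of_dvd_sum (U := U) (q := p ^ i) (Q := p ^ (i + J))
    (c := fun u => curve p (ZMod p) (a' ω) (c u)) (x := curve p (ZMod p) (a' ω) (X l))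
    (h := curve p (ZMod p) (a' ω) h) ?_ (pow_pos hp.pos _) ?_ (pow_dvd_pow _ hiJ)
    (fun u _ => ⟨_, hpow u⟩) ?_ ?_ u₀ hu₀)
  · rw [curve_X, ha'l, hiu]
    exact order_powSubOne p i hu
  · rw [pow_add, mul_comm]
    exact Nat.mul_lt_mul_of_pos_left hJ (pow_pos hp.pos _)
  · have := Ideal.mem_map_of_mem (curve p (ZMod p) (a' ω)) hh
    rw [Ideal.map_span, ← Set.image_comp] at this
    exact this
  · rw [hcurve, hexp, map_add, map_sum, map_mul, map_pow] at h5
    simpa only [map_mul, map_pow] using h5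

end Restriction

/-! ### The `p`-adic topology of a finite free `ℤ_p`-algebra. -/

section Finite

variable (p : ℕ) [Fact p.Prime] (B : Type*) [CommRing B] [Algebra ℤ_[p] B]
  [Module.Finite ℤ_[p] B] [Module.Free ℤ_[p] B]

instance isAdicComplete_of_free : IsAdicComplete (IsLocalRing.maximalIdeal ℤ_[p]) B where
  prec' := by
    intro f hf
    let b := Module.Free.chooseBasis ℤ_[p] B
    have hL : ∀ i, ∃ L : ℤ_[p], ∀ n, b.repr (f n) i ≡ L
        [SMOD (IsLocalRing.maximalIdeal ℤ_[p] ^ n • ⊤ : Submodule ℤ_[p] ℤ_[p])] := by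
      intro i
      refine IsPrecomplete.prec' (I := IsLocalRing.maximalIdeal ℤ_[p]) (M := ℤ_[p])
        (fun n => b.repr (f n) i) fun {m n} hmn => ?_
      have h1 := (hf hmn).map (b.coord i)
      refine SModEq.mono ?_ h1
      rw [Submodule.map_smul'']
      exact Submodule.smul_mono le_rfl le_top
    choose L hL using hL
    refine ⟨∑ i, L i • b i, fun n => ?_⟩
    rw [← b.sum_repr (f n), SModEq.sub_mem, ← Finset.sum_sub_distrib]
    refine Submodule.sum_mem _ fun i _ => ?_
    rw [← sub_smul]
    have h1 := SModEq.sub_mem.mp (hL i n)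
    rw [smul_eq_mul, Ideal.mul_top] at h1
    exact Submodule.smul_mem_smul h1 trivial

/-- The ideal `p B`. -/
def pIdeal : Ideal B := (IsLocalRing.maximalIdeal ℤ_[p]).map (algebraMap ℤ_[p] B)

instance isAdicComplete_pIdeal : IsAdicComplete (pIdeal p B) B :=
  (IsAdicComplete.map_algebraMap_iff _ _).mpr inferInstance

/-- The elements of `B` that are nilpotent modulo `p`. -/
def topNil : Ideal B := (pIdeal p B).radical

theorem topNil_le_jacobson : topNil p B ≤ Ideal.jacobson ⊥ := by
  have h : (pIdeal p B) ≤ Ideal.jacobson ⊥ := IsAdicComplete.le_jacobson_bot _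
  exact (Ideal.radical_mono h).trans (Ideal.radical_le_jacobson.trans Ideal.jacobson_idem.le)

omit [Module.Finite ℤ_[p] B] [Module.Free ℤ_[p] B] in
theorem natCast_mem_pIdeal : (p : B) ∈ pIdeal p B := by
  have : (p : ℤ_[p]) ∈ IsLocalRing.maximalIdeal ℤ_[p] := by
    rw [PadicInt.maximalIdeal_eq_span_p]
    exact Ideal.mem_span_singleton_self _
  rw [← map_natCast (algebraMap ℤ_[p] B)]
  exact Ideal.mem_map_of_mem (algebraMap ℤ_[p] B) this

omit [Module.Finite ℤ_[p] B] [Module.Free ℤ_[p] B] in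
-- Modulo `p`, `(ζ - 1) ^ p ^ k = ζ ^ p ^ k - 1 = 0`.
theorem sub_one_mem_topNil {ζ : B} {k : ℕ} (hζ : ζ ^ p ^ k = 1) : ζ - 1 ∈ topNil p B := by
  refine ⟨p ^ k, ?_⟩
  rw [← Ideal.Quotient.eq_zero_iff_mem, map_pow, map_sub, map_one]
  rcases subsingleton_or_nontrivial (B ⧸ pIdeal p B) with h | h
  · exact Subsingleton.elim _ _
  · have hp0 : (p : B ⧸ pIdeal p B) = 0 := by
      rw [← map_natCast (Ideal.Quotient.mk (pIdeal p B)), Ideal.Quotient.eq_zero_iff_mem]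
      exact natCast_mem_pIdeal p B
    have : CharP (B ⧸ pIdeal p B) p := (CharP.charP_iff_prime_eq_zero Fact.out).mpr hp0
    rw [sub_pow_char_pow, ← map_pow, hζ, map_one, one_pow, sub_self]

instance isHausdorff_topNil : IsHausdorff (topNil p B) B := by
  have : IsNoetherianRing B := IsNoetherianRing.of_finite ℤ_[p] B
  exact IsHausdorff.of_le_jacobson _ _ (topNil_le_jacobson p B)

/-- The power series whose constant term is nilpotent modulo `p`. -/
def topNilSeries (τ : Type*) : Ideal (MvPowerSeries τ B) := (topNil p B).comap constantCoeff

theorem topNilSeries_le_jacobson (τ : Type*) : topNilSeries p B τ ≤ Ideal.jacobson ⊥ := by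
  intro f hf
  rw [Ideal.mem_jacobson_bot]
  intro g
  rw [MvPowerSeries.isUnit_iff_constantCoeff, map_add, map_mul, map_one]
  exact Ideal.mem_jacobson_bot.mp (topNil_le_jacobson p B hf) _

theorem isHausdorff_topNilSeries_quotient {τ : Type*} [Finite τ] (H : Ideal (MvPowerSeries τ B)) :
    IsHausdorff (topNilSeries p B τ) (MvPowerSeries τ B ⧸ H) := by
  have : IsNoetherianRing B := IsNoetherianRing.of_finite ℤ_[p] B
  exact IsHausdorff.of_le_jacobson _ _ (topNilSeries_le_jacobson p B τ)

open scoped MvPowerSeries.WithPiTopology in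
/-- Evaluation of power series over `B` at topologically nilpotent power series. -/
theorem exists_algHom_X {σ τ : Type*} [Finite σ] (d : σ → MvPowerSeries τ B)
    (hd : ∀ i, d i ∈ topNilSeries p B τ) :
    ∃ φ : MvPowerSeries σ B →ₐ[B] MvPowerSeries τ B, ∀ i, φ (X i) = d i := by
  -- For the `p`-adic topology `B` is complete and the elements of `topNil` are topologically
  -- nilpotent, so substitution converges.
  let _ : WithIdeal B := ⟨pIdeal p B⟩
  have hadic : IsAdic (pIdeal p B) := rfl
  obtain ⟨h1, h2⟩ := hadic.isAdicComplete_iff.mp (isAdicComplete_pIdeal p B)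
  have hnil : ∀ i, IsTopologicallyNilpotent (d i) := by
    intro i
    refine MvPowerSeries.LinearTopology.isTopologicallyNilpotent_of_constantCoeff ?_
    obtain ⟨k, hk⟩ := hd i
    rw [IsTopologicallyNilpotent, hadic.hasBasis_nhds_zero.tendsto_right_iff]
    intro m _
    filter_upwards [Filter.eventually_ge_atTop (k * m)] with r hr
    refine Ideal.mem_of_dvd _ (pow_dvd_pow _ hr) ?_
    rw [pow_mul]
    exact Ideal.pow_mem_pow hk m
  have he : MvPowerSeries.HasEval d := ⟨hnil, by simp⟩
  refine ⟨MvPowerSeries.aeval he, fun i => ?_⟩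
  have := MvPowerSeries.aeval_coe (R := B) he (MvPolynomial.X i)
  simpa using this

end Finite

/-! ### Evaluation at points and `p`-adic powers of elements near `1`. -/

section Evaluation

variable {p : ℕ} [Fact p.Prime] {B : Type*} [CommRing B] [Algebra ℤ_[p] B]
  [Module.Finite ℤ_[p] B] [Module.Free ℤ_[p] B] {σ : Type*} [Finite σ]

/-- Evaluation of power series over `B` at a topologically nilpotent point. -/
def evalHom (x : σ → B) (hx : ∀ i, x i ∈ topNil p B) : MvPowerSeries σ B →+* B :=
  constantCoeff.comp (exists_algHom_X p B (fun i => (C (x i) : MvPowerSeries σ B))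
    (fun i => by simpa [topNilSeries] using hx i)).choose.toRingHom

theorem evalHom_X (x : σ → B) (hx : ∀ i, x i ∈ topNil p B) (i : σ) :
    evalHom x hx (X i) = x i := by
  have := (exists_algHom_X p B (fun i => (C (x i) : MvPowerSeries σ B))
    (fun i => by simpa [topNilSeries] using hx i)).choose_spec i
  simp [evalHom, this]

theorem evalHom_C (x : σ → B) (hx : ∀ i, x i ∈ topNil p B) (c : B) :
    evalHom x hx (C c) = c := by
  simp [evalHom, algHom_C]

variable (p) in
theorem ringHom_ext_of_topNil {O : Type*} [CommRing O] {φ ψ : MvPowerSeries σ O →+* B}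
    (hC : ∀ c, φ (C c) = ψ (C c)) (hX : ∀ i, φ (X i) = ψ (X i))
    (hJ : ∀ i, φ (X i) ∈ topNil p B) : φ = ψ :=
  ringHom_ext_of_isHausdorff (topNil p B) hC hX hJ

/-- A power series that vanishes after setting `X_i = x_i` for `i ∈ S` lies in the ideal
`(X_i - x_i : i ∈ S)`. -/
theorem sub_mem_span_of_map_X (S : Set σ) {x : σ → B} (hx : ∀ i ∈ S, x i ∈ topNil p B)
    {φ : MvPowerSeries σ B →ₐ[B] MvPowerSeries σ B} (hS : ∀ i ∈ S, φ (X i) = C (x i))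
    (hS' : ∀ i ∉ S, φ (X i) = X i) (f : MvPowerSeries σ B) :
    f - φ f ∈ Ideal.span ((fun i => X i - C (x i)) '' S) := by
  have := isHausdorff_topNilSeries_quotient p B
    (Ideal.span ((fun i => (X i : MvPowerSeries σ B) - C (x i)) '' S))
  rw [← neg_sub, neg_mem_iff]
  refine ringHom_sub_mem_of_isHausdorff _ (topNilSeries p B σ) (φ := φ.toRingHom)
    (ψ := RingHom.id _) (fun c => ?_) (fun i => ?_) (fun i => ?_) f
  · simp [algHom_C]
  · by_cases hi : i ∈ S
    · rw [← neg_mem_iff]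
      refine Ideal.subset_span ⟨i, hi, ?_⟩
      simp [hS i hi]
    · simp [hS' i hi]
  · by_cases hi : i ∈ S
    · simpa [hS i hi, topNilSeries] using hx i hi
    · simp [hS' i hi, topNilSeries]

/-- The power `η ^ b` of an element `η ≡ 1` for a `p`-adic integer `b`. -/
def padicPow (η : B) (hη : η - 1 ∈ topNil p B) (b : ℤ_[p]) : B :=
  evalHom (σ := Unit) (fun _ => η - 1) (fun _ => hη) (PowerSeries.binomialSeries B b)

variable {η : B} (hη : η - 1 ∈ topNil p B)

theorem padicPow_add (a b : ℤ_[p]) :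
    padicPow η hη (a + b) = padicPow η hη a * padicPow η hη b := by
  rw [padicPow, PowerSeries.binomialSeries_add, map_mul, padicPow, padicPow]

theorem evalHom_powerSeries_X (x : Unit → B) (hx : ∀ i, x i ∈ topNil p B) :
    evalHom x hx (PowerSeries.X : PowerSeries B) = x () := evalHom_X x hx ()

theorem padicPow_natCast (m : ℕ) : padicPow η hη m = η ^ m := by
  rw [padicPow, PowerSeries.binomialSeries_nat, map_pow, map_add, map_one, evalHom_powerSeries_X,
    add_sub_cancel]

theorem padicPow_zero : padicPow η hη 0 = 1 := by
  simpa using padicPow_natCast hη 0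

theorem evalHom_powSubOne (a : ℤ_[p]) : evalHom (σ := Unit) (fun _ => η - 1) (fun _ => hη)
    (powSubOne p B a) = padicPow η hη a - 1 := by
  rw [powSubOne, map_sub, map_one, padicPow]

/-- `(1 + T) ^ (p ^ N) - 1` vanishes at `η - 1`, so substituting it and then evaluating is the
constant coefficient map, which sends `(1 + T) ^ c` to `1`. -/
theorem padicPow_pow_mul {N : ℕ} (hN : η ^ p ^ N = 1) (c : ℤ_[p]) :
    padicPow η hη ((p : ℤ_[p]) ^ N * c) = 1 := by
  have h0 : evalHom (σ := Unit) (fun _ => η - 1) (fun _ => hη)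
      (powSubOne p B ((p : ℤ_[p]) ^ N)) = 0 := by
    rw [evalHom_powSubOne, ← Nat.cast_pow, padicPow_natCast, hN, sub_self]
  have hs := hasSubst_powSubOne p B ((p : ℤ_[p]) ^ N)
  have h1 : (evalHom (σ := Unit) (fun _ => η - 1) (fun _ => hη)).comp
      (PowerSeries.substAlgHom (R := B) hs).toRingHom = constantCoeff := by
    have hX : (evalHom (σ := Unit) (fun _ => η - 1) (fun _ => hη)).comp
      (PowerSeries.substAlgHom (R := B) hs).toRingHom PowerSeries.X = 0 := by
      rw [RingHom.comp_apply]
      change evalHom _ _ (PowerSeries.substAlgHom (R := B) hs PowerSeries.X) = 0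
      rw [PowerSeries.substAlgHom_X, h0]
    refine ringHom_ext_of_topNil p (fun c => ?_) (fun i => ?_) fun i => ?_
    · rw [RingHom.comp_apply]
      change evalHom _ _ (PowerSeries.substAlgHom (R := B) hs (algebraMap B _ c)) = _
      rw [AlgHom.commutes]
      exact (evalHom_C _ _ c).trans (constantCoeff_C c).symm
    · refine hX.trans ?_
      exact (constantCoeff_X (R := B) i).symm
    · have : (evalHom (σ := Unit) (fun _ => η - 1) (fun _ => hη)).comp
        (PowerSeries.substAlgHom (R := B) hs).toRingHom (X i) = 0 := hX
      rw [this]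
      exact Ideal.zero_mem _
  have h2 := DFunLike.congr_fun h1 (PowerSeries.binomialSeries B c)
  have h3 : constantCoeff (PowerSeries.binomialSeries B c) = 1 :=
    PowerSeries.binomialSeries_constantCoeff c
  rw [h3, RingHom.comp_apply] at h2
  change evalHom _ _ (PowerSeries.substAlgHom (R := B) hs _) = 1 at h2
  rw [PowerSeries.coe_substAlgHom] at h2
  rw [mul_comm, padicPow, ← subst_binomialSeries]
  exact h2

/-- Evaluation at the point `(η ^ (a i) - 1)_i`. -/
def evalCurve (η : B) (hη : η - 1 ∈ topNil p B) (a : σ → ℤ_[p]) : MvPowerSeries σ B →+* B :=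
  (evalHom (σ := Unit) (fun _ => η - 1) (fun _ => hη)).comp (curve p B a).toRingHom

theorem evalCurve_apply (a : σ → ℤ_[p]) (f : MvPowerSeries σ B) : evalCurve η hη a f =
    evalHom (σ := Unit) (fun _ => η - 1) (fun _ => hη) (curve p B a f) := rfl

theorem evalCurve_X (a : σ → ℤ_[p]) (i : σ) :
    evalCurve η hη a (X i) = padicPow η hη (a i) - 1 := by
  rw [evalCurve_apply, curve_X, evalHom_powSubOne]

theorem evalCurve_C (a : σ → ℤ_[p]) (c : B) : evalCurve η hη a (C c) = c := by
  rw [evalCurve_apply, algHom_C, evalHom_C]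

end Evaluation

/-! ### Compatibility with change of coefficients. -/

section Maps

variable {p : ℕ} [Fact p.Prime] {O O' : Type*} [CommRing O] [Algebra ℤ_[p] O]
  [CommRing O'] [Algebra ℤ_[p] O'] {σ : Type*} [Finite σ]

theorem map_curve [IsNoetherianRing O'] {g : O →+* O'}
    (hg : g.comp (algebraMap ℤ_[p] O) = algebraMap ℤ_[p] O') (a : σ → ℤ_[p])
    (f : MvPowerSeries σ O) :
    MvPowerSeries.map g (curve p O a f) = curve p O' a (MvPowerSeries.map g f) := by
  have hX : ∀ i, MvPowerSeries.map g (curve p O a (X i)) = powSubOne p O' (a i) := by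
    intro i
    rw [curve_X]
    change PowerSeries.map g _ = _
    rw [powSubOne, map_sub, map_one, map_binomialSeries p O g hg, powSubOne]
  have : (MvPowerSeries.map g).comp (curve p O a).toRingHom =
      (curve p O' a).toRingHom.comp (MvPowerSeries.map g) := by
    refine ringHom_ext_of_constantCoeff (fun c => ?_) (fun i => ?_) fun i => ?_
    · simp [algHom_C]
    · refine (hX i).trans ?_
      simp [curve_X]
    · refine (congrArg constantCoeff (hX i)).trans (constantCoeff_powSubOne p O' _)
  exact DFunLike.congr_fun this f

omit [Algebra ℤ_[p] O] [Algebra ℤ_[p] O'] in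
theorem map_keepVars [DecidableEq σ] [IsNoetherianRing O'] (g : O →+* O') (s : Finset σ)
    (f : MvPowerSeries σ O) :
    MvPowerSeries.map g (keepVars O s f) = keepVars O' s (MvPowerSeries.map g f) := by
  have hX : ∀ i, MvPowerSeries.map g (keepVars O s (X i)) = if i ∈ s then X i else 0 := by
    intro i
    rw [keepVars_X]
    split_ifs <;> simp
  have : (MvPowerSeries.map g).comp (keepVars O s).toRingHom =
      (keepVars O' s).toRingHom.comp (MvPowerSeries.map g) := by
    refine ringHom_ext_of_constantCoeff (fun c => ?_) (fun i => ?_) fun i => ?_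
    · simp [algHom_C]
    · refine (hX i).trans ?_
      simp [keepVars_X]
    · refine (congrArg constantCoeff (hX i)).trans ?_
      split_ifs <;> simp
  exact DFunLike.congr_fun this f

end Maps

/-! ### Zeros at roots of unity and divisibility modulo `p`. -/

section Cyclotomic

variable {p : ℕ} [Fact p.Prime] {B : Type*} [CommRing B] [IsDomain B] [Algebra ℤ_[p] B]
  [Module.Finite ℤ_[p] B] [Module.Free ℤ_[p] B]

omit [Algebra ℤ_[p] B] [Module.Finite ℤ_[p] B] [Module.Free ℤ_[p] B] in
-- `p` is the value at `1` of the cyclotomic polynomial, a product of `p ^ N * (p - 1)` factors `1 -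
-- η ^ i`, each divisible by `η - 1`.
theorem sub_one_pow_dvd_prime {η : B} {N : ℕ} (hη : IsPrimitiveRoot η (p ^ (N + 1))) :
    (η - 1) ^ p ^ N ∣ (p : B) := by
  have h := Polynomial.eval_one_cyclotomic_prime_pow (R := B) (p := p) N
  rw [Polynomial.cyclotomic_eq_prod_X_sub_primitiveRoots hη, Polynomial.eval_prod] at h
  rw [← h]
  have hdvd : ∀ μ ∈ primitiveRoots (p ^ (N + 1)) B,
      (η - 1) ∣ Polynomial.eval 1 (Polynomial.X - Polynomial.C μ) := by
    intro μ hμ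
    rw [mem_primitiveRoots (pow_pos (Fact.out : p.Prime).pos _)] at hμ
    obtain ⟨i, -, rfl⟩ := hη.eq_pow_of_pow_eq_one hμ.pow_eq_one
    rw [Polynomial.eval_sub, Polynomial.eval_X, Polynomial.eval_C, ← neg_sub (η ^ i), dvd_neg]
    simpa using sub_dvd_pow_sub_pow η 1 i
  refine (pow_dvd_pow _ ?_).trans (Finset.prod_const (η - 1) ▸ Finset.prod_dvd_prod_of_dvd _ _ hdvd)
  rw [hη.card_primitiveRoots, Nat.totient_prime_pow_succ Fact.out]
  exact Nat.le_mul_of_pos_right _ (Nat.sub_pos_of_lt (Fact.out : p.Prime).one_lt)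

theorem exists_eq_C_mul_add_X_pow_mul {k : PowerSeries ℤ_[p]} {r : ℕ}
    (hr : ∀ m < r, (p : ℤ_[p]) ∣ PowerSeries.coeff m k) :
    ∃ k₀, k = PowerSeries.C (p : ℤ_[p]) * k₀ +
      PowerSeries.X ^ r * PowerSeries.mk fun m => PowerSeries.coeff (m + r) k := by
  choose! b hb using hr
  refine ⟨PowerSeries.mk fun m => if m < r then b m else 0, ?_⟩
  ext m
  rw [map_add, PowerSeries.coeff_C_mul, PowerSeries.coeff_mk, PowerSeries.coeff_X_pow_mul']
  split_ifs with h1 h2 h2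
  · omega
  · rw [add_zero, hb m h1]
  · rw [mul_zero, zero_add, PowerSeries.coeff_mk, Nat.sub_add_cancel h2]
  · omega

/-- A power series over `ℤ_p` that vanishes at `η - 1`, for a primitive `p ^ N`-th root of
unity `η`, vanishes to high order modulo `p`. -/
theorem X_pow_dvd_map_of_evalHom_eq_zero {η : B} {N : ℕ} (hprim : IsPrimitiveRoot η (p ^ N))
    (hη : η - 1 ∈ topNil p B) {k : PowerSeries ℤ_[p]}
    (hk : evalHom (σ := Unit) (fun _ => η - 1) (fun _ => hη)
      (PowerSeries.map (algebraMap ℤ_[p] B) k) = 0) :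
    PowerSeries.X ^ p ^ (N - 1) ∣ PowerSeries.map (PadicInt.toZMod (p := p)) k := by
  classical
  set e := evalHom (σ := Unit) (fun _ => η - 1) (fun _ => hη) with he
  have heX : e (PowerSeries.X : PowerSeries B) = η - 1 := evalHom_powerSeries_X _ _
  have hker : ∀ z : ℤ_[p], PadicInt.toZMod z = 0 ↔ (p : ℤ_[p]) ∣ z := by
    intro z
    rw [← RingHom.mem_ker, PadicInt.ker_toZMod, PadicInt.maximalIdeal_eq_span_p,
      Ideal.mem_span_singleton]
  by_contra hcon
  rw [PowerSeries.X_pow_dvd_iff] at hcon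
  push Not at hcon
  have hex : ∃ r, r < p ^ (N - 1) ∧ ¬ (p : ℤ_[p]) ∣ PowerSeries.coeff r k := by
    obtain ⟨r, hr, hr'⟩ := hcon
    exact ⟨r, hr, by rwa [PowerSeries.coeff_map, Ne, hker] at hr'⟩
  obtain ⟨hr, hru⟩ := Nat.find_spec hex
  have hmin : ∀ m < Nat.find hex, (p : ℤ_[p]) ∣ PowerSeries.coeff m k := by
    intro m hm
    by_contra h
    exact Nat.find_min hex hm ⟨hm.trans hr, h⟩
  -- As in Weierstrass preparation, `r` is the first index with a unit coefficient, and `k = p * k₀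
  -- + T ^ r * u` with `u` a unit.
  set r := Nat.find hex
  obtain ⟨k₀, hk₀⟩ := exists_eq_C_mul_add_X_pow_mul hmin
  set u : PowerSeries ℤ_[p] := PowerSeries.mk fun m => PowerSeries.coeff (m + r) k with hu
  have huu : IsUnit u := by
    rw [PowerSeries.isUnit_iff_constantCoeff, ← PowerSeries.coeff_zero_eq_constantCoeff_apply, hu,
      PowerSeries.coeff_mk, zero_add]
    by_contra h
    apply hru
    rw [← Ideal.mem_span_singleton, ← PadicInt.maximalIdeal_eq_span_p]
    exact (IsLocalRing.mem_maximalIdeal _).mpr h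
  have hEu : IsUnit (e (PowerSeries.map (algebraMap ℤ_[p] B) u)) := (huu.map _).map e
  have hx : η - 1 ∈ Ideal.jacobson (⊥ : Ideal B) := topNil_le_jacobson p B hη
  have hxu : ¬ IsUnit (η - 1) := by
    intro h
    have := Ideal.mem_jacobson_bot.mp hx (-h.unit⁻¹)
    rw [mul_neg, IsUnit.mul_val_inv, neg_add_cancel] at this
    exact not_isUnit_zero this
  -- Evaluate this decomposition at `η - 1`, where `k` vanishes.
  have hpx : (p : B) ∣ (η - 1) ^ r := by
    rw [hk₀, map_add, map_mul, map_mul, map_pow, PowerSeries.map_C, PowerSeries.map_X, map_add,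
      map_mul, map_mul, map_pow, heX, map_natCast] at hk
    have hC : e (PowerSeries.C (p : B)) = p := evalHom_C _ _ _
    rw [hC] at hk
    rw [← hEu.dvd_mul_right, eq_neg_of_add_eq_zero_right hk, dvd_neg]
    exact dvd_mul_right _ _
  -- For `N = 0` the truncated `N - 1` is `0`, so `r = 0` and `p` would be a unit of `B`.
  rcases N with _ | N
  · simp only [Nat.zero_sub, pow_zero, Nat.lt_one_iff] at hr
    rw [hr, pow_zero] at hpx
    have h1 := Ideal.mem_of_dvd _ hpx (natCast_mem_pIdeal p B)
    have h2 : (1 : B) ∈ topNil p B := Ideal.le_radical h1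
    have h3 := Ideal.mem_jacobson_bot.mp (topNil_le_jacobson p B h2) (-1)
    simp at h3
  · have hpos : η - 1 ≠ 0 := by
      intro h
      rw [sub_eq_zero] at h
      rw [h] at hprim
      have h1 := hprim.unique IsPrimitiveRoot.one
      exact (Nat.one_lt_pow (by omega) (Fact.out : p.Prime).one_lt).ne' h1
    have h1 := (sub_one_pow_dvd_prime hprim).trans hpx
    rw [Nat.add_sub_cancel] at hr
    have h2 := (pow_dvd_pow_iff hpos hxu).mp h1
    omega

end Cyclotomic

instance isDomain_mvPowerSeries {σ R : Type*} [CommRing R] [IsDomain R] :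
    IsDomain (MvPowerSeries σ R) := NoZeroDivisors.to_isDomain _

/-! ### Reduction to power series over `ℤ_p` not divisible by `p`. -/

section Integrality

variable {p : ℕ} [Fact p.Prime] {B : Type*} [CommRing B] [IsDomain B] [Algebra ℤ_[p] B]
  [Module.Finite ℤ_[p] B] [Module.Free ℤ_[p] B] {n : ℕ}

omit [IsDomain B] in
-- A `ℤ_p`-basis of `B` writes `g` as a finite combination of series over `ℤ_p` with coefficients
-- integral over `ℤ_p`.
theorem isIntegralElem_map (g : MvPowerSeries (Fin n) B) :
    (MvPowerSeries.map (σ := Fin n) (algebraMap ℤ_[p] B)).IsIntegralElem g := by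
  let b := Module.Free.chooseBasis ℤ_[p] B
  have hg : g = ∑ i, C (b i) * MvPowerSeries.map (algebraMap ℤ_[p] B)
      (fun m => b.repr (coeff m g) i : MvPowerSeries (Fin n) ℤ_[p]) := by
    ext m
    simp only [map_sum, coeff_C_mul]
    conv_lhs => rw [← b.sum_repr (coeff m g)]
    refine Finset.sum_congr rfl fun i _ => ?_
    rw [Algebra.smul_def, mul_comm]
    rfl
  rw [hg]
  refine Finset.sum_induction _ (MvPowerSeries.map (σ := Fin n) (algebraMap ℤ_[p] B)).IsIntegralElem
    (fun _ _ => RingHom.IsIntegralElem.add _) (RingHom.isIntegralElem_zero _) fun i _ => ?_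
  refine RingHom.IsIntegralElem.mul _ ?_ (RingHom.isIntegralElem_map _)
  obtain ⟨q, hq, hq0⟩ := Algebra.IsIntegral.isIntegral (R := ℤ_[p]) (b i)
  refine ⟨q.map (C : ℤ_[p] →+* MvPowerSeries (Fin n) ℤ_[p]), hq.map _, ?_⟩
  rw [Polynomial.eval₂_map]
  have h1 : (MvPowerSeries.map (σ := Fin n) (algebraMap ℤ_[p] B)).comp C =
      (C : B →+* MvPowerSeries (Fin n) B).comp (algebraMap ℤ_[p] B) := by
    ext1 c
    simp
  rw [h1, ← Polynomial.hom_eval₂, hq0, map_zero]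

/-- A nonzero power series over `B` in the variables `s` divides a nonzero power series over `ℤ_p`
in these variables. -/
theorem exists_dvd_map {s : Finset (Fin n)} {g : MvPowerSeries (Fin n) B} (hg0 : g ≠ 0)
    (hg : keepVars B s g = g) : ∃ h : MvPowerSeries (Fin n) ℤ_[p], h ≠ 0 ∧
      keepVars ℤ_[p] s h = h ∧ g ∣ MvPowerSeries.map (algebraMap ℤ_[p] B) h := by
  have : IsNoetherianRing B := IsNoetherianRing.of_finite ℤ_[p] B
  obtain ⟨q, hq, hq0⟩ := isIntegralElem_map (p := p) g
  set i := MvPowerSeries.map (σ := Fin n) (algebraMap ℤ_[p] B) with hi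
  -- Applying `keepVars` to the integral equation fixes `g` and moves the coefficients into the
  -- variables `s`.
  let j : MvPowerSeries (Fin n) ℤ_[p] →+* MvPowerSeries (Fin n) B :=
    (keepVars B s).toRingHom.comp i
  have hj : ∀ h, j h = i (keepVars ℤ_[p] s h) := fun h => (map_keepVars _ s h).symm
  have hqj : q.eval₂ j g = 0 := by
    have h1 := congrArg (keepVars B s).toRingHom hq0
    rw [Polynomial.hom_eval₂, map_zero] at h1
    have h2 : (keepVars B s).toRingHom g = g := hg
    rwa [h2] at h1
  have hint : IsIntegral j.range g := by
    refine ⟨q.map j.rangeRestrict, hq.map _, ?_⟩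
    rw [Polynomial.eval₂_map]
    exact hqj
  -- In a domain, an integral equation of `g` with nonzero constant term shows that this term is a
  -- multiple of `g`.
  have hne := Ideal.comap_ne_bot_of_integral_mem (I := Ideal.span {g}) hg0
    (Ideal.mem_span_singleton_self g) hint
  obtain ⟨⟨_, h, rfl⟩, hmem, hx⟩ := Submodule.exists_mem_ne_zero_of_ne_bot hne
  refine ⟨keepVars ℤ_[p] s h, ?_, ?_, ?_⟩
  · rintro h0
    apply hx
    ext1
    change j h = 0
    rw [hj, h0, map_zero]
  · rw [keepVars_keepVars, Finset.inter_self]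
  · rw [← hj, ← Ideal.mem_span_singleton]
    exact hmem

theorem exists_eq_C_pow_mul {s : Finset (Fin n)} {h : MvPowerSeries (Fin n) ℤ_[p]} (h0 : h ≠ 0)
    (hs : keepVars ℤ_[p] s h = h) : ∃ (c : ℕ) (h₁ : MvPowerSeries (Fin n) ℤ_[p]),
      h = C (p : ℤ_[p]) ^ c * h₁ ∧ keepVars ℤ_[p] s h₁ = h₁ ∧
      MvPowerSeries.map (PadicInt.toZMod (p := p)) h₁ ≠ 0 := by
  have hpu : ¬ IsUnit (C (p : ℤ_[p]) : MvPowerSeries (Fin n) ℤ_[p]) := by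
    rw [MvPowerSeries.isUnit_iff_constantCoeff, constantCoeff_C]
    exact PadicInt.prime_p.not_isUnit
  have hp0 : (C (p : ℤ_[p]) : MvPowerSeries (Fin n) ℤ_[p]) ≠ 0 := by
    rw [Ne, map_eq_zero_iff _ C_injective]
    exact PadicInt.prime_p.ne_zero
  obtain ⟨h₁, hh₁, hndvd⟩ := (FiniteMultiplicity.of_not_isUnit hpu h0).exists_eq_pow_mul_and_not_dvd
  refine ⟨_, h₁, hh₁, ?_, ?_⟩
  · have h1 := hs
    rw [hh₁, map_mul, map_pow, algHom_C] at h1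
    exact mul_left_cancel₀ (pow_ne_zero _ hp0) h1
  · intro hz
    apply hndvd
    have hdiv : ∀ m, (p : ℤ_[p]) ∣ coeff m h₁ := by
      intro m
      have h1 := congrArg (coeff m) hz
      rw [coeff_map, map_zero] at h1
      rwa [← RingHom.mem_ker, PadicInt.ker_toZMod, PadicInt.maximalIdeal_eq_span_p,
        Ideal.mem_span_singleton] at h1
    choose d hd using hdiv
    let h₂ : MvPowerSeries (Fin n) ℤ_[p] := d
    have hh₂ : ∀ m, coeff m h₂ = d m := fun m => rfl
    refine ⟨h₂, ?_⟩
    ext m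
    rw [coeff_C_mul, hd, hh₂]

end Integrality

/-! ### Rigidity for generic families of torsion points. -/

section Generic

variable {p : ℕ} [Fact p.Prime] {Ω : Type*} {𝒰 : Ultrafilter Ω} {B : Ω → Type*}
  [∀ ω, CommRing (B ω)] [∀ ω, IsDomain (B ω)] [∀ ω, Algebra ℤ_[p] (B ω)]
  [∀ ω, Module.Finite ℤ_[p] (B ω)] [∀ ω, Module.Free ℤ_[p] (B ω)] {n : ℕ}

/-- Nonzero power series over `ℤ_p` do not vanish at a generic family of torsion points. -/
theorem eventually_evalCurve_ne_zero {N : Ω → ℕ} {η : ∀ ω, B ω}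
    (hprim : ∀ ω, IsPrimitiveRoot (η ω) (p ^ N ω)) (hη : ∀ ω, η ω - 1 ∈ topNil p (B ω))
    {s : Finset (Fin n)} {a : Ω → Fin n → ℤ_[p]}
    (hgen : ∀ τ : Fin n → ℤ_[p], (∃ i ∈ s, τ i ≠ 0) →
      ∀ᶠ ω in (𝒰 : Filter Ω), padicPow (η ω) (hη ω) (∑ i ∈ s, τ i * a ω i) ≠ 1)
    {h : MvPowerSeries (Fin n) ℤ_[p]} (h0 : h ≠ 0) (hs : keepVars ℤ_[p] s h = h) :
    ∀ᶠ ω in (𝒰 : Filter Ω),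
      evalCurve (η ω) (hη ω) (a ω) (MvPowerSeries.map (algebraMap ℤ_[p] (B ω)) h) ≠ 0 := by
  let _ : Algebra ℤ_[p] (ZMod p) := (PadicInt.toZMod (p := p)).toAlgebra
  have hpne : (p : ℤ_[p]) ≠ 0 := PadicInt.prime_p.ne_zero
  obtain ⟨c, h₁, rfl, hs₁, hne⟩ := exists_eq_C_pow_mul h0 hs
  have hgen' : ∀ τ : Fin n → ℤ_[p], (∃ i ∈ s, τ i ≠ 0) →
      ∀ᶠ ω in (𝒰 : Filter Ω), ¬ (p : ℤ_[p]) ^ (N ω - 1) ∣ ∑ i ∈ s, τ i * a ω i := by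
    rintro τ ⟨i, hi, hτ⟩
    -- Scaling the relation by `p` makes up for the loss from `N` to `N - 1`; the truncated
    -- subtraction is harmless for `N = 0`.
    filter_upwards [hgen (fun i => p * τ i) ⟨i, hi, mul_ne_zero hpne hτ⟩] with ω hω hdvd
    apply hω
    have h1 : (p : ℤ_[p]) ^ N ω ∣ ∑ i ∈ s, p * τ i * a ω i := by
      simp_rw [mul_assoc]
      rw [← Finset.mul_sum]
      refine (pow_dvd_pow _ (by omega : N ω ≤ (N ω - 1) + 1)).trans ?_
      rw [pow_succ']
      exact mul_dvd_mul_left _ hdvd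
    obtain ⟨z, hz⟩ := h1
    rw [hz]
    exact padicPow_pow_mul (hη ω) (hprim ω).pow_eq_one z
  have hsm : keepVars (ZMod p) s (MvPowerSeries.map (PadicInt.toZMod (p := p)) h₁) =
      MvPowerSeries.map (PadicInt.toZMod (p := p)) h₁ := by rw [← map_keepVars, hs₁]
  filter_upwards [eventually_not_X_pow_dvd_curve p 𝒰 (fun ω => N ω - 1) s a hgen' _ hne hsm]
    with ω hω hzero
  have : IsNoetherianRing (B ω) := IsNoetherianRing.of_finite ℤ_[p] (B ω)
  apply hω
  rw [map_mul, map_mul, map_pow, map_pow, map_C, evalCurve_C] at hzero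
  have hpB : algebraMap ℤ_[p] (B ω) p ≠ 0 := by
    intro h
    rw [← map_zero (algebraMap ℤ_[p] (B ω))] at h
    exact hpne (FaithfulSMul.algebraMap_injective ℤ_[p] (B ω) h)
  have h2 := (mul_eq_zero.mp hzero).resolve_left (pow_ne_zero _ hpB)
  rw [evalCurve_apply, ← map_curve (O := ℤ_[p]) (g := algebraMap ℤ_[p] (B ω)) rfl] at h2
  have h3 := X_pow_dvd_map_of_evalHom_eq_zero (hprim ω) (hη ω) (k := curve p ℤ_[p] (a ω) h₁) h2
  have h4 := map_curve (O := ℤ_[p]) (g := PadicInt.toZMod (p := p)) (O' := ZMod p) rfl (a ω) h₁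
  rw [← h4]
  exact h3

/-- A power series that vanishes at a generic family of torsion points is zero. -/
theorem eq_zero_of_eventually_evalCurve_eq_zero {N : Ω → ℕ} {η : ∀ ω, B ω}
    (hprim : ∀ ω, IsPrimitiveRoot (η ω) (p ^ N ω)) (hη : ∀ ω, η ω - 1 ∈ topNil p (B ω))
    {s : Finset (Fin n)} {a : Ω → Fin n → ℤ_[p]}
    (hgen : ∀ τ : Fin n → ℤ_[p], (∃ i ∈ s, τ i ≠ 0) →
      ∀ᶠ ω in (𝒰 : Filter Ω), padicPow (η ω) (hη ω) (∑ i ∈ s, τ i * a ω i) ≠ 1)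
    {B₀ : Type*} [CommRing B₀] [IsDomain B₀] [Algebra ℤ_[p] B₀] [Module.Finite ℤ_[p] B₀]
    [Module.Free ℤ_[p] B₀] {g : MvPowerSeries (Fin n) B₀} (hs : keepVars B₀ s g = g)
    (hg : ∀ᶠ ω in (𝒰 : Filter Ω), ∃ ι : B₀ →ₐ[ℤ_[p]] B ω,
      evalCurve (η ω) (hη ω) (a ω) (MvPowerSeries.map ι.toRingHom g) = 0) : g = 0 := by
  by_contra hg0
  obtain ⟨h, h0, hsh, hdvd⟩ := exists_dvd_map (p := p) hg0 hs
  have h1 := eventually_evalCurve_ne_zero hprim hη hgen h0 hsh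
  obtain ⟨ω, h2, ι, h3⟩ := (h1.and hg).exists
  apply h2
  obtain ⟨g', hg'⟩ := hdvd
  have h4 := congrArg (MvPowerSeries.map ι.toRingHom) hg'
  have h5 : ι.toRingHom.comp (algebraMap ℤ_[p] B₀) = algebraMap ℤ_[p] (B ω) := ι.comp_algebraMap
  rw [← RingHom.comp_apply, ← MvPowerSeries.map_comp, h5] at h4
  rw [h4, map_mul, map_mul, h3, zero_mul]

end Generic

/-! ### Effect of the elementary changes of variables on curves. -/

section Changes

variable {p : ℕ} [Fact p.Prime] {O : Type*} [CommRing O] [Algebra ℤ_[p] O] [IsNoetherianRing O]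
  {n : ℕ}

omit [Algebra ℤ_[p] O] [IsNoetherianRing O] in
theorem swap_X (l m i : Fin n) : substAlgHom (R := O) (hasSubst_swapTuple O l m) (X i) =
    X (Equiv.swap l m i) := substAlgHom_X' _ i

theorem swap_surjective (l m : Fin n) :
    Function.Surjective (substAlgHom (R := O) (hasSubst_swapTuple O l m)) := by
  have : (substAlgHom (R := O) (hasSubst_swapTuple O l m)).comp
      (substAlgHom (R := O) (hasSubst_swapTuple O l m)) = AlgHom.id O _ := by
    refine algHom_ext_of_constantCoeff (fun i => ?_) fun i => ?_
    · rw [AlgHom.comp_apply, swap_X, swap_X, Equiv.swap_apply_self, AlgHom.id_apply]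
    · rw [AlgHom.comp_apply, swap_X, swap_X, constantCoeff_X]
  exact fun f => ⟨_, DFunLike.congr_fun this f⟩

theorem curve_swap (l m : Fin n) (b : Fin n → ℤ_[p]) (f : MvPowerSeries (Fin n) O) :
    curve p O b (substAlgHom (R := O) (hasSubst_swapTuple O l m) f) =
      curve p O (b ∘ Equiv.swap l m) f := by
  have : (curve p O b).comp (substAlgHom (R := O) (hasSubst_swapTuple O l m)) =
      curve p O (b ∘ Equiv.swap l m) := by
    refine algHom_ext_of_constantCoeff (fun i => ?_) fun i => ?_
    · rw [AlgHom.comp_apply, swap_X, curve_X, curve_X, Function.comp_apply]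
    · rw [AlgHom.comp_apply, swap_X, constantCoeff_curve_X]
  exact DFunLike.congr_fun this f

omit [IsNoetherianRing O] in
theorem unipotent_X (M : Fin n → Fin n → ℤ_[p]) (i : Fin n) :
    substAlgHom (R := O) (hasSubst_unipotentTuple p O M) (X i) =
      (1 + X i) * ∏ j ∈ Finset.Iio i, onePlusXPow p O j (M i j) - 1 := substAlgHom_X' _ i

theorem curve_unipotent (M : Fin n → Fin n → ℤ_[p]) (b : Fin n → ℤ_[p])
    (f : MvPowerSeries (Fin n) O) :
    curve p O b (substAlgHom (R := O) (hasSubst_unipotentTuple p O M) f) =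
      curve p O (fun i => b i + ∑ j ∈ Finset.Iio i, M i j * b j) f := by
  have hX : ∀ i, curve p O b (substAlgHom (R := O) (hasSubst_unipotentTuple p O M) (X i)) =
      powSubOne p O (b i + ∑ j ∈ Finset.Iio i, M i j * b j) := by
    intro i
    have hsum : ∀ s : Finset (Fin n), PowerSeries.binomialSeries O (∑ j ∈ s, M i j * b j) =
        ∏ j ∈ s, PowerSeries.binomialSeries O (M i j * b j) := by
      intro s
      induction s using Finset.induction_on with
      | empty => simp
      | insert j s hj ih =>
        rw [Finset.sum_insert hj, Finset.prod_insert hj, PowerSeries.binomialSeries_add, ih]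
    rw [unipotent_X, map_sub, map_mul, map_add, map_one, map_prod, curve_X]
    simp_rw [curve_onePlusXPow]
    rw [powSubOne, powSubOne, add_sub_cancel, PowerSeries.binomialSeries_add, hsum]
  have : (curve p O b).comp (substAlgHom (R := O) (hasSubst_unipotentTuple p O M)) =
      curve p O (fun i => b i + ∑ j ∈ Finset.Iio i, M i j * b j) := by
    refine algHom_ext_of_constantCoeff (fun i => ?_) fun i => ?_
    · rw [AlgHom.comp_apply, hX, curve_X]
    · rw [AlgHom.comp_apply, hX]
      exact constantCoeff_powSubOne p O _
  exact DFunLike.congr_fun this f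

/-- The substitution that only changes the variable `X_m`. -/
def singleRow (m : Fin n) (q : Fin n → ℤ_[p]) (i j : Fin n) : ℤ_[p] := if i = m then q j else 0

/-- Only `X m` moves, by powers of variables that stay fixed, so the substitution with `-q` is a
right inverse. -/
theorem unipotent_singleRow_surjective (m : Fin n) (q : Fin n → ℤ_[p]) :
    Function.Surjective
      (substAlgHom (R := O) (hasSubst_unipotentTuple p O (singleRow m q))) := by
  have hfix : ∀ q' : Fin n → ℤ_[p], ∀ i, i ≠ m →
      substAlgHom (R := O) (hasSubst_unipotentTuple p O (singleRow m q')) (X i) = X i := by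
    intro q' i hi
    rw [unipotent_X]
    simp [singleRow, hi, onePlusXPow_zero]
  have hX : ∀ i, substAlgHom (R := O) (hasSubst_unipotentTuple p O (singleRow m q))
      (substAlgHom (R := O) (hasSubst_unipotentTuple p O (singleRow m (-q))) (X i)) = X i := by
    intro i
    by_cases hi : i = m
    · subst hi
      rw [unipotent_X, map_sub, map_mul, map_add, map_one, map_prod, unipotent_X]
      have hpow : ∀ j ∈ Finset.Iio i, substAlgHom (R := O)
          (hasSubst_unipotentTuple p O (singleRow i q))
          (onePlusXPow p O j (singleRow i (-q) i j)) = onePlusXPow p O j (-q j) := by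
        intro j hj
        have hji : j ≠ i := (Finset.mem_Iio.mp hj).ne
        rw [map_onePlusXPow_of_map_X (ψ := AlgHom.id O _) (by rw [hfix q j hji]; simp)
          (hfix q j hji)]
        simp [singleRow]
      rw [Finset.prod_congr rfl hpow, add_sub_cancel, mul_assoc, ← Finset.prod_mul_distrib]
      simp [singleRow, ← onePlusXPow_add, onePlusXPow_zero]
    · rw [hfix _ i hi, hfix _ i hi]
  have : (substAlgHom (R := O) (hasSubst_unipotentTuple p O (singleRow m q))).comp
      (substAlgHom (R := O) (hasSubst_unipotentTuple p O (singleRow m (-q)))) = AlgHom.id O _ := by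
    refine algHom_ext_of_constantCoeff hX fun i => ?_
    rw [AlgHom.comp_apply, hX, constantCoeff_X]
  exact fun f => ⟨_, DFunLike.congr_fun this f⟩

end Changes

/-! ### Separating constant and generic coordinates. -/

section Structure

variable {p : ℕ} [Fact p.Prime] {O : Type*} [CommRing O] [Algebra ℤ_[p] O] [IsNoetherianRing O]
  {n : ℕ} {Ω K : Type*} [Field K] (𝒰 : Ultrafilter Ω)

/-- After the multiplicative change of variables `θ`, the family `a` becomes `b`, and the
coordinates of `b` in `S` give the constants `ε` under `pw`. -/
structure IsAdapted (pw : Ω → ℤ_[p] → K) (a : Ω → Fin n → ℤ_[p])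
    (θ : MvPowerSeries (Fin n) O →ₐ[O] MvPowerSeries (Fin n) O) (b : Ω → Fin n → ℤ_[p])
    (S : Finset (Fin n)) (ε : Fin n → K) : Prop where
  isMultChange : IsMultChange p O θ
  surjective : Function.Surjective θ
  curve_eq : ∀ ω f, curve p O (b ω) (θ f) = curve p O (a ω) f
  eventually_eq : ∀ i ∈ S, ∀ᶠ ω in (𝒰 : Filter Ω), pw ω (b ω i) = ε i

variable {𝒰} {pw : Ω → ℤ_[p] → K} {a b : Ω → Fin n → ℤ_[p]}
  {θ : MvPowerSeries (Fin n) O →ₐ[O] MvPowerSeries (Fin n) O} {S : Finset (Fin n)} {ε : Fin n → K}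

omit [Field K] in
theorem IsAdapted.swap (h : IsAdapted 𝒰 pw a θ b S ε) (l m : Fin n) :
    IsAdapted 𝒰 pw a ((substAlgHom (hasSubst_swapTuple O l m)).comp θ)
      (fun ω => b ω ∘ Equiv.swap l m) (S.map (Equiv.swap l m).toEmbedding)
      (ε ∘ Equiv.swap l m) where
  isMultChange := .swap_comp l m h.isMultChange
  surjective := (swap_surjective l m).comp h.surjective
  curve_eq ω f := by
    rw [AlgHom.comp_apply, curve_swap, ← h.curve_eq ω f]
    congr 2
    funext i
    simp
  eventually_eq i hi := by
    obtain ⟨j, hj, rfl⟩ := Finset.mem_map.mp hi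
    simpa using h.eventually_eq j hj

omit [Field K] in
-- A unipotent substitution changes a variable only by earlier ones, so the last variable is the one
-- that can absorb a combination of all the others.
theorem IsAdapted.insert_last {n : ℕ} {a b : Ω → Fin (n + 1) → ℤ_[p]}
    {θ : MvPowerSeries (Fin (n + 1)) O →ₐ[O] MvPowerSeries (Fin (n + 1)) O}
    {S : Finset (Fin (n + 1))} {ε : Fin (n + 1) → K}
    (h : IsAdapted 𝒰 pw a θ b S ε) (hS : Fin.last n ∉ S) {q : Fin (n + 1) → ℤ_[p]}
    (hq : q (Fin.last n) = 1) {ε₀ : K}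
    (hε₀ : ∀ᶠ ω in (𝒰 : Filter Ω), pw ω (∑ i, q i * b ω i) = ε₀) :
    ∃ θ' b' ε', IsAdapted (O := O) 𝒰 pw a θ' b' (insert (Fin.last n) S) ε' := by
  -- The sign: the old last exponent is recovered from the new one, `∑ q i * b i`, by subtracting
  -- the other terms.
  refine ⟨(substAlgHom (hasSubst_unipotentTuple p O (singleRow (Fin.last n) (-q)))).comp θ,
    fun ω => Function.update (b ω) (Fin.last n) (∑ i, q i * b ω i),
    Function.update ε (Fin.last n) ε₀, .unipotent_comp _ h.isMultChange,
    (unipotent_singleRow_surjective _ _).comp h.surjective, fun ω f => ?_, fun i hi => ?_⟩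
  · rw [AlgHom.comp_apply, curve_unipotent, ← h.curve_eq ω f]
    congr 2
    funext i
    by_cases hi : i = Fin.last n
    · subst hi
      have hIio : Finset.Iio (Fin.last n) = Finset.univ.erase (Fin.last n) := by
        ext j
        rw [Finset.mem_Iio, Finset.mem_erase, Fin.lt_last_iff_ne_last]
        simp
      rw [Function.update_self, ← Finset.add_sum_erase _ _ (Finset.mem_univ (Fin.last n)), hq,
        one_mul, add_assoc, hIio, ← Finset.sum_add_distrib, Finset.sum_eq_zero, add_zero]
      intro j hj
      rw [Function.update_of_ne (Finset.ne_of_mem_erase hj)]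
      simp [singleRow]
    · simp [singleRow, hi]
  · rcases Finset.mem_insert.mp hi with rfl | hi
    · simpa using hε₀
    · have hne : i ≠ Fin.last n := fun h => hS (h ▸ hi)
      simpa [Function.update_of_ne hne] using h.eventually_eq i hi

variable {N : Ω → ℕ} (hadd : ∀ ω x y, pw ω (x + y) = pw ω x * pw ω y) (hzero : ∀ ω, pw ω 0 = 1)
  (htors : ∀ ω x, pw ω ((p : ℤ_[p]) ^ N ω * x) = 1)

include hadd hzero in
theorem pw_natCast_mul (ω : Ω) (m : ℕ) (x : ℤ_[p]) : pw ω (m * x) = pw ω x ^ m := by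
  induction m with
  | zero => simp [hzero]
  | succ m ih => rw [Nat.cast_succ, add_mul, one_mul, hadd, ih, pow_succ]

include hadd hzero htors in
-- Since `p ^ N` acts trivially, `c` may be replaced by a natural number congruent to it modulo `p ^
-- N`.
theorem pw_mul_eq_one (ω : Ω) (c : ℤ_[p]) {x : ℤ_[p]} (hx : pw ω x = 1) : pw ω (c * x) = 1 := by
  obtain ⟨d, hd⟩ := Ideal.mem_span_singleton.mp (PadicInt.appr_spec (N ω) c)
  rw [sub_eq_iff_eq_add.mp hd, add_mul, hadd, pw_natCast_mul hadd hzero, hx, one_pow, mul_one,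
    mul_assoc, htors]

include hadd hzero htors in
/-- If the coordinates outside `S` satisfy a relation, then `S` can be enlarged. -/
theorem IsAdapted.exists_insert (h : IsAdapted 𝒰 pw a θ b S ε) {τ : Fin n → ℤ_[p]} {i : Fin n}
    (hi : i ∈ Sᶜ) (hτi : τ i ≠ 0)
    (hτ : ∀ᶠ ω in (𝒰 : Filter Ω), pw ω (∑ i ∈ Sᶜ, τ i * b ω i) = 1) :
    ∃ θ' b' S' ε', IsAdapted (O := O) 𝒰 pw a θ' b' S' ε' ∧ S'.card = S.card + 1 := by
  classical
  -- Dividing the relation by its coefficient of least valuation gives integral coefficients `q`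
  -- with `q l = 1`.
  obtain ⟨l, hl, hdvd⟩ := exists_forall_dvd ⟨i, hi⟩ τ
  have hτl : τ l ≠ 0 := fun h0 => hτi (by simpa [h0] using hdvd i hi)
  choose! q₀ hq₀ using hdvd
  let q : Fin n → ℤ_[p] := fun m => if m ∈ Sᶜ then q₀ m else 0
  have hql : q l = 1 := by
    have h1 := hq₀ l hl
    have h2 : q₀ l = 1 := mul_left_cancel₀ hτl (by rw [← h1, mul_one])
    simp only [q, if_pos hl, h2]
  have hsum : ∀ ω, ∑ i ∈ Sᶜ, τ i * b ω i = τ l * ∑ i, q i * b ω i := by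
    intro ω
    rw [Finset.mul_sum, ← Finset.sum_subset (Finset.subset_univ Sᶜ)]
    · refine Finset.sum_congr rfl fun m hm => ?_
      simp only [q, if_pos hm]
      rw [← mul_assoc, ← hq₀ m hm]
    · intro m _ hm
      have : q m = 0 := if_neg hm
      rw [this, zero_mul, mul_zero]
  obtain ⟨c, u, hu⟩ : ∃ (c : ℕ) (u : ℤ_[p]), u * τ l = ((p ^ c : ℕ) : ℤ_[p]) := by
    refine ⟨(τ l).valuation, ↑(PadicInt.unitCoeff hτl)⁻¹, ?_⟩
    exact (congrArg _ (PadicInt.unitCoeff_spec hτl)).trans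
      ((Units.inv_mul_cancel_left _ _).trans (Nat.cast_pow p _).symm)
  -- The value is a `p ^ c`-th root of unity with `c` independent of `ω`. There are finitely many in
  -- `K`, so one of them is taken almost everywhere.
  have hroot : ∀ᶠ ω in (𝒰 : Filter Ω), ∃ z ∈ Polynomial.nthRootsFinset (p ^ c) (1 : K),
      pw ω (∑ i, q i * b ω i) = z := by
    filter_upwards [hτ] with ω hω
    refine ⟨_, ?_, rfl⟩
    rw [Polynomial.mem_nthRootsFinset (pow_pos (Fact.out : p.Prime).pos _),
      ← pw_natCast_mul hadd hzero, ← hu, mul_assoc, ← hsum]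
    exact pw_mul_eq_one hadd hzero htors ω u hω
  obtain ⟨ε₀, -, hε₀⟩ := eventually_exists_mem_finset 𝒰 _ hroot
  obtain _ | n := n
  · exact l.elim0
  have h1 := h.swap l (Fin.last n)
  have hlast : Fin.last n ∉ S.map (Equiv.swap l (Fin.last n)).toEmbedding := by
    intro hmem
    obtain ⟨j, hj, hj'⟩ := Finset.mem_map.mp hmem
    have : j = l := by
      have h2 : Equiv.swap l (Fin.last n) j = Fin.last n := hj'
      rw [Equiv.swap_apply_eq_iff] at h2
      simpa using h2
    exact Finset.mem_compl.mp hl (this ▸ hj)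
  obtain ⟨θ', b', ε', h'⟩ := h1.insert_last hlast (q := q ∘ Equiv.swap l (Fin.last n))
    (by simpa using hql) (ε₀ := ε₀) (by
      filter_upwards [hε₀] with ω hω
      rw [← hω]
      congr 1
      exact Equiv.sum_comp (Equiv.swap l (Fin.last n)) fun i => q i * b ω i)
  exact ⟨θ', b', _, ε', h', by rw [Finset.card_insert_of_notMem hlast, Finset.card_map]⟩

variable (O) (𝒰) (a) in
include hadd hzero htors in
/-- Each family of torsion points becomes generic in a subset of the coordinates and constant in
the others after a multiplicative change of variables. -/
theorem exists_isAdapted_generic : ∃ θ b S ε, IsAdapted (O := O) 𝒰 pw a θ b S ε ∧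
    ∀ τ : Fin n → ℤ_[p], (∃ i ∈ Sᶜ, τ i ≠ 0) →
      ∀ᶠ ω in (𝒰 : Filter Ω), pw ω (∑ i ∈ Sᶜ, τ i * b ω i) ≠ 1 := by
  by_contra! hcon
  have key : ∀ k : ℕ, ∃ θ b S ε, IsAdapted (O := O) 𝒰 pw a θ b S ε ∧ S.card = k := by
    intro k
    induction k with
    | zero => exact ⟨AlgHom.id O _, a, ∅, 0, ⟨.id, Function.surjective_id, fun _ _ => rfl,
        by simp⟩, rfl⟩
    | succ k ih =>
      obtain ⟨θ, b, S, ε, h, rfl⟩ := ih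
      obtain ⟨τ, ⟨i, hi, hτi⟩, hτ⟩ := hcon θ b S ε h
      exact h.exists_insert hadd hzero htors hi hτi hτ
  obtain ⟨_, _, S, _, _, hS⟩ := key (n + 1)
  have := S.card_le_univ
  rw [hS, Fintype.card_fin] at this
  omega

end Structure

/-! ### Rings of integers inside the algebraic closure. -/

section Integers

variable {p : ℕ} [Fact p.Prime] {F : Type*} [Field F] [Algebra ℚ_[p] F]
  [FiniteDimensional ℚ_[p] F] [Algebra ℤ_[p] F] [IsScalarTower ℤ_[p] ℚ_[p] F]

omit [FiniteDimensional ℚ_[p] F] in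
variable (p F) in
theorem isTorsionFree_padicInt : Module.IsTorsionFree ℤ_[p] F := .trans_faithfulSMul ℤ_[p] ℚ_[p] F

instance finite_integers : Module.Finite ℤ_[p] (Integers p F) :=
  IsIntegralClosure.finite ℤ_[p] ℚ_[p] F _

instance free_integers : Module.Free ℤ_[p] (Integers p F) :=
  have := isTorsionFree_padicInt p F
  IsIntegralClosure.module_free ℤ_[p] ℚ_[p] F _

instance isNoetherianRing_integers : IsNoetherianRing (Integers p F) :=
  IsNoetherianRing.of_finite ℤ_[p] _

variable {L L' : IntermediateField F (AlgebraicClosure F)}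

omit [FiniteDimensional ℚ_[p] F] in
instance isScalarTower_intermediateField : IsScalarTower ℤ_[p] ℚ_[p] L :=
  .of_algebraMap_eq fun x => Subtype.ext <| by
    change algebraMap ℤ_[p] (AlgebraicClosure F) x =
      algebraMap ℚ_[p] (AlgebraicClosure F) (algebraMap ℤ_[p] ℚ_[p] x)
    rw [IsScalarTower.algebraMap_apply ℤ_[p] F, IsScalarTower.algebraMap_apply ℚ_[p] F,
      ← IsScalarTower.algebraMap_apply ℤ_[p] ℚ_[p] F]

instance finiteDimensional_padic [FiniteDimensional F L] : FiniteDimensional ℚ_[p] L :=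
  Module.Finite.trans F L


variable (p L) in
/-- The inclusion of the integers of `L` into the algebraic closure. -/
def toClosure : Integers p L →+* AlgebraicClosure F :=
  L.val.toRingHom.comp (Integers p L).val.toRingHom

omit [Algebra ℚ_[p] F] [FiniteDimensional ℚ_[p] F] [IsScalarTower ℤ_[p] ℚ_[p] F] in
theorem toClosure_injective : Function.Injective (toClosure p L) :=
  Subtype.val_injective.comp Subtype.val_injective

/-- The inclusion of the integers of `L` into those of a larger field. -/
def inclusionIntegers (h : L ≤ L') : Integers p L →ₐ[ℤ_[p]] Integers p L' :=
  ((IntermediateField.inclusion h).restrictScalars ℤ_[p]).mapIntegralClosure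

omit [Algebra ℚ_[p] F] [FiniteDimensional ℚ_[p] F] [IsScalarTower ℤ_[p] ℚ_[p] F] in
theorem toClosure_inclusionIntegers (h : L ≤ L') (x : Integers p L) :
    toClosure p L' (inclusionIntegers h x) = toClosure p L x := rfl

omit [Algebra ℚ_[p] F] [FiniteDimensional ℚ_[p] F] [IsScalarTower ℤ_[p] ℚ_[p] F] in
theorem inclusionIntegers_injective (h : L ≤ L') :
    Function.Injective (inclusionIntegers (p := p) h) := fun x y hxy =>
  toClosure_injective (by
    rw [← toClosure_inclusionIntegers h, hxy, toClosure_inclusionIntegers])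

omit [Algebra ℚ_[p] F] [FiniteDimensional ℚ_[p] F] [IsScalarTower ℤ_[p] ℚ_[p] F] in
theorem map_extendScalars {n : ℕ} (h : L ≤ L') (f : PSeries p F n) :
    MvPowerSeries.map (inclusionIntegers h).toRingHom (extendScalars p F L f) =
      extendScalars p F L' f := by
  ext m
  rfl

omit [Algebra ℚ_[p] F] [FiniteDimensional ℚ_[p] F] [IsScalarTower ℤ_[p] ℚ_[p] F] in
theorem exists_toClosure_eq {z : AlgebraicClosure F} (hz : z ∈ L) {k : ℕ} (hk : z ^ p ^ k = 1) :
    ∃ x : Integers p L, toClosure p L x = z := by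
  refine ⟨⟨⟨z, hz⟩, ?_⟩, rfl⟩
  refine IsIntegral.of_pow (pow_pos (Fact.out : p.Prime).pos k) ?_
  have : (⟨z, hz⟩ : L) ^ p ^ k = 1 := Subtype.ext hk
  rw [this]
  exact isIntegral_one

end Integers

/-! ### Special points as kernels of evaluations. -/

section TorsionDatum

variable (p : ℕ) [Fact p.Prime] (F : Type*) [Field F] [Algebra ℚ_[p] F]
  [FiniteDimensional ℚ_[p] F] [Algebra ℤ_[p] F] [IsScalarTower ℤ_[p] ℚ_[p] F] (n : ℕ)

/-- A torsion point whose coordinates are written as powers of one root of unity. -/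
structure TorsionPoint where
  /-- The field of definition. -/
  field : IntermediateField F (AlgebraicClosure F)
  /-- The field of definition is finite over `F`. -/
  finiteDimensional : FiniteDimensional F field
  /-- The order of the root of unity is `p ^ level`. -/
  level : ℕ
  /-- The root of unity. -/
  root : Integers p field
  isPrimitiveRoot : IsPrimitiveRoot root (p ^ level)
  /-- The exponents of the coordinates. -/
  exponent : Fin n → ℤ_[p]

attribute [instance] TorsionPoint.finiteDimensional

variable {p F n}

omit [Algebra ℚ_[p] F] [FiniteDimensional ℚ_[p] F] [IsScalarTower ℤ_[p] ℚ_[p] F] in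
theorem TorsionPoint.root_sub_one_mem (t : TorsionPoint p F n) :
    t.root - 1 ∈ topNil p (Integers p t.field) :=
  sub_one_mem_topNil p _ t.isPrimitiveRoot.pow_eq_one

/-- Evaluation of power series over `𝒪_F` at a torsion point. -/
def TorsionPoint.eval (t : TorsionPoint p F n) : PSeries p F n →+* Integers p t.field :=
  (evalCurve t.root t.root_sub_one_mem t.exponent).comp (extendScalars p F t.field)

/-- Substituting the constants `ζ i - 1` for all variables changes `f` by an element of the ideal,
and the result is the constant series given by the evaluation. -/
theorem mem_hyperplanesIdeal_univ_iff {L : IntermediateField F (AlgebraicClosure F)}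
    [FiniteDimensional F L] {ζ : Fin n → Integers p L}
    (hζ : ∀ i, ζ i - 1 ∈ topNil p (Integers p L)) (f : PSeries p L n) :
    f ∈ hyperplanesIdeal p F L Set.univ ζ ↔ evalHom (fun i => ζ i - 1) hζ f = 0 := by
  constructor
  · intro hf
    have hle : hyperplanesIdeal p F L Set.univ ζ ≤
        RingHom.ker (evalHom (fun i => ζ i - 1) hζ) := by
      refine Ideal.span_le.mpr ?_
      rintro _ ⟨i, -, rfl⟩
      rw [SetLike.mem_coe, RingHom.mem_ker, map_sub, evalHom_X, evalHom_C, sub_self]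
    exact hle hf
  · intro hf
    obtain ⟨φ, hφ⟩ := exists_algHom_X (σ := Fin n) (τ := Fin n) p (Integers p L)
      (fun i => C (ζ i - 1)) (fun i => by simpa [topNilSeries] using hζ i)
    have h1 := sub_mem_span_of_map_X Set.univ (fun i _ => hζ i) (φ := φ) (fun i _ => hφ i)
      (fun i hi => (hi trivial).elim) f
    have h2 : φ.toRingHom = C.comp (evalHom (fun i => ζ i - 1) hζ) := by
      have := isHausdorff_topNilSeries_quotient p (Integers p L)
        (⊥ : Ideal (MvPowerSeries (Fin n) (Integers p L)))
      ext1 g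
      refine sub_eq_zero.mp (ringHom_sub_mem_of_isHausdorff ⊥
        (topNilSeries p (Integers p L) (Fin n)) (fun c => ?_) (fun i => ?_) (fun i => ?_) g)
      · simp [algHom_C, evalHom_C]
      · simp [hφ, evalHom_X]
      · simpa [hφ, topNilSeries] using hζ i
    have h3 : φ f = 0 := (DFunLike.congr_fun h2 f).trans (by rw [RingHom.comp_apply, hf, map_zero])
    rw [h3, sub_zero] at h1
    exact h1

/-- Special points are the kernels of the evaluations at torsion points. -/
theorem exists_torsionPoint {P : Ideal (PSeries p F n)} (hP : IsSpecialPoint p F P) :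
    ∃ t : TorsionPoint p F n, P = RingHom.ker t.eval := by
  obtain ⟨L₀, hL₀, ζ, hζ, rfl⟩ := hP
  choose k hk using hζ
  have hζ' : ∀ i, ζ i - 1 ∈ topNil p (Integers p L₀) := fun i => sub_one_mem_topNil p _ (hk i)
  let N := Finset.univ.sup k
  have hN : ∀ i, ζ i ^ p ^ N = 1 := by
    intro i
    obtain ⟨c, hc⟩ := pow_dvd_pow p (Finset.le_sup (f := k) (Finset.mem_univ i))
    change ζ i ^ p ^ Finset.univ.sup k = 1
    rw [hc, pow_mul, hk, one_pow]
  have : CharZero F := charZero_of_injective_algebraMap (algebraMap ℚ_[p] F).injective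
  have : NeZero ((p ^ N : ℕ) : AlgebraicClosure F) :=
    ⟨Nat.cast_ne_zero.mpr (pow_pos (Fact.out : p.Prime).pos N).ne'⟩
  obtain ⟨η₀, hη₀⟩ := HasEnoughRootsOfUnity.exists_primitiveRoot (AlgebraicClosure F) (p ^ N)
  have : FiniteDimensional F (IntermediateField.adjoin F {η₀}) :=
    IntermediateField.adjoin.finiteDimensional (Algebra.IsIntegral.isIntegral η₀)
  -- A primitive `p ^ N`-th root of unity is adjoined. The integers of `L₀` embed in those of `L`,
  -- so the kernel of the evaluation is unchanged.
  let L := L₀ ⊔ IntermediateField.adjoin F {η₀}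
  have hle : L₀ ≤ L := le_sup_left
  obtain ⟨η, hη⟩ := exists_toClosure_eq (p := p) (L := L) (z := η₀)
    ((le_sup_right : _ ≤ L) (IntermediateField.mem_adjoin_simple_self F η₀)) hη₀.pow_eq_one
  have hprim : IsPrimitiveRoot η (p ^ N) :=
    .of_map_of_injective (f := toClosure p L) (hη ▸ hη₀) toClosure_injective
  have hpow : ∀ i, ∃ m : ℕ, η ^ m = inclusionIntegers hle (ζ i) := by
    intro i
    obtain ⟨m, -, hm⟩ := hprim.eq_pow_of_pow_eq_one (ξ := inclusionIntegers hle (ζ i))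
      (by rw [← map_pow, hN, map_one])
    exact ⟨m, hm⟩
  choose m hm using hpow
  let t : TorsionPoint p F n := ⟨L, inferInstance, N, η, hprim, fun i => m i⟩
  refine ⟨t, Ideal.ext fun f => ?_⟩
  rw [Ideal.mem_comap, mem_hyperplanesIdeal_univ_iff hζ', RingHom.mem_ker,
    ← map_eq_zero_iff _ (inclusionIntegers_injective (p := p) hle)]
  have hcomp : (evalCurve η t.root_sub_one_mem fun i => (m i : ℤ_[p])).comp
      (MvPowerSeries.map (inclusionIntegers hle).toRingHom) =
      (inclusionIntegers hle).toRingHom.comp (evalHom (fun i => ζ i - 1) hζ') := by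
    have hX : ∀ i, evalCurve η t.root_sub_one_mem (fun i => (m i : ℤ_[p]))
        (MvPowerSeries.map (inclusionIntegers hle).toRingHom (X i)) =
        inclusionIntegers hle (ζ i) - 1 := by
      intro i
      rw [map_X, evalCurve_X, padicPow_natCast, hm]
    refine ringHom_ext_of_topNil p (fun c => ?_) (fun i => ?_) fun i => ?_
    · rw [RingHom.comp_apply, RingHom.comp_apply, map_C, evalCurve_C, evalHom_C]
    · refine (hX i).trans ?_
      rw [RingHom.comp_apply, evalHom_X]
      exact ((map_sub _ _ _).trans (by rw [map_one]; rfl)).symm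
    · rw [RingHom.comp_apply, hX]
      refine sub_one_mem_topNil p _ (k := N) ?_
      rw [← map_pow, hN, map_one]
  have h1 := DFunLike.congr_fun hcomp (extendScalars p F L₀ f)
  rw [RingHom.comp_apply, map_extendScalars] at h1
  exact Eq.congr_left h1.symm

end TorsionDatum

/-! ### The ideal of a family of torsion points along an ultrafilter. -/

section Families

variable {p : ℕ} [Fact p.Prime] {F : Type*} [Field F] [Algebra ℚ_[p] F]
  [FiniteDimensional ℚ_[p] F] [Algebra ℤ_[p] F] [IsScalarTower ℤ_[p] ℚ_[p] F] {n : ℕ}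

namespace TorsionPoint

/-- The `p`-adic powers of the root of unity, in the algebraic closure. -/
def pow (t : TorsionPoint p F n) (x : ℤ_[p]) : AlgebraicClosure F :=
  toClosure p t.field (padicPow t.root t.root_sub_one_mem x)

variable (t : TorsionPoint p F n)

theorem pow_add (x y : ℤ_[p]) : t.pow (x + y) = t.pow x * t.pow y := by
  rw [pow, padicPow_add, map_mul, pow, pow]

theorem pow_zero : t.pow 0 = 1 := by rw [pow, padicPow_zero, map_one]

theorem pow_pow_level_mul (x : ℤ_[p]) : t.pow ((p : ℤ_[p]) ^ t.level * x) = 1 := by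
  rw [pow, padicPow_pow_mul _ t.isPrimitiveRoot.pow_eq_one, map_one]

theorem pow_pow_level (x : ℤ_[p]) : t.pow x ^ p ^ t.level = 1 := by
  have h := t.pow_pow_level_mul x
  rwa [← Nat.cast_pow, pw_natCast_mul (pw := fun _ : Unit => t.pow) (fun _ => t.pow_add)
    (fun _ => t.pow_zero) ()] at h

theorem pow_mem (x : ℤ_[p]) : t.pow x ∈ t.field := 
  ((padicPow t.root t.root_sub_one_mem x : Integers p t.field) : t.field).2

theorem padicPow_sub_one_mem (x : ℤ_[p]) :
    padicPow t.root t.root_sub_one_mem x - 1 ∈ topNil p (Integers p t.field) := by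
  refine sub_one_mem_topNil p _ (k := t.level) (toClosure_injective ?_)
  rw [map_pow, map_one]
  exact t.pow_pow_level x

/-- Evaluation of power series over a subfield at a torsion point with given exponents. -/
def evalOver {M : IntermediateField F (AlgebraicClosure F)} (hM : M ≤ t.field)
    (b : Fin n → ℤ_[p]) : PSeries p M n →+* Integers p t.field :=
  (evalCurve t.root t.root_sub_one_mem b).comp
    (MvPowerSeries.map (inclusionIntegers hM).toRingHom)

variable {M : IntermediateField F (AlgebraicClosure F)} (hM : M ≤ t.field)

theorem evalOver_C (b : Fin n → ℤ_[p]) (c : Integers p M) :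
    t.evalOver hM b (C c) = inclusionIntegers hM c := by
  rw [evalOver, RingHom.comp_apply, map_C, evalCurve_C]
  rfl

theorem evalOver_X (b : Fin n → ℤ_[p]) (i : Fin n) :
    t.evalOver hM b (X i) = padicPow t.root t.root_sub_one_mem (b i) - 1 := by
  rw [evalOver, RingHom.comp_apply, map_X, evalCurve_X]

theorem evalOver_extendScalars {b : Fin n → ℤ_[p]}
    {θ : PSeries p F n →ₐ[Integers p F] PSeries p F n}
    (hθ : ∀ f, curve p (Integers p F) b (θ f) = curve p (Integers p F) t.exponent f)
    (f : PSeries p F n) : t.evalOver hM b (extendScalars p F M (θ f)) = t.eval f := by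
  have hg : ((IsScalarTower.toAlgHom ℤ_[p] F t.field).mapIntegralClosure.toRingHom).comp
      (algebraMap ℤ_[p] (Integers p F)) = algebraMap ℤ_[p] (Integers p t.field) :=
    
    RingHom.ext fun c =>
      AlgHom.commutes (IsScalarTower.toAlgHom ℤ_[p] F t.field).mapIntegralClosure c
  rw [evalOver, RingHom.comp_apply, map_extendScalars, eval, RingHom.comp_apply, evalCurve_apply,
    evalCurve_apply, extendScalars, ← map_curve hg, ← map_curve hg, hθ]

variable {S : Finset (Fin n)} {ζ : Fin n → Integers p M} {b : Fin n → ℤ_[p]}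
  (hζ : ∀ i ∈ S, t.pow (b i) = toClosure p M (ζ i))

include hζ in
theorem padicPow_eq {i : Fin n} (hi : i ∈ S) :
    padicPow t.root t.root_sub_one_mem (b i) = inclusionIntegers hM (ζ i) :=
  toClosure_injective (hζ i hi)

include hζ in
theorem hyperplanesIdeal_le_ker_evalOver :
    hyperplanesIdeal p F M S ζ ≤ RingHom.ker (t.evalOver hM b) := by
  refine Ideal.span_le.mpr ?_
  rintro _ ⟨i, hi, rfl⟩
  rw [SetLike.mem_coe, RingHom.mem_ker, map_sub, evalOver_X, evalOver_C,
    t.padicPow_eq hM hζ hi, map_sub, map_one, sub_self]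

include hζ in
-- At these points the variables in `S` already take the values `ζ i - 1`, so specializing them
-- beforehand changes nothing.
theorem evalOver_comp {ρ : PSeries p M n →ₐ[Integers p M] PSeries p M n}
    (hρ : ∀ i, ρ (X i) = if i ∈ S then C (ζ i - 1) else X i) (f : PSeries p M n) :
    t.evalOver hM b (ρ f) = t.evalOver hM b f := by
  have hX : ∀ i, t.evalOver hM b (ρ (X i)) =
      padicPow t.root t.root_sub_one_mem (b i) - 1 := by
    intro i
    rw [hρ]
    split_ifs with hi
    · rw [evalOver_C, t.padicPow_eq hM hζ hi, map_sub, map_one]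
    · rw [evalOver_X]
  have : (t.evalOver hM b).comp ρ.toRingHom = t.evalOver hM b := by
    refine ringHom_ext_of_topNil p (fun c => ?_) (fun i => ?_) fun i => ?_
    · exact congrArg (t.evalOver hM b) (algHom_C ρ c)
    · exact (hX i).trans (t.evalOver_X hM b i).symm
    · have h1 := t.padicPow_sub_one_mem (b i)
      rw [← hX] at h1
      exact h1
  exact DFunLike.congr_fun this f

end TorsionPoint

theorem keepVars_compl_of_map_X {B : Type*} [CommRing B] [Algebra ℤ_[p] B] [Module.Finite ℤ_[p] B]
    [Module.Free ℤ_[p] B] {S : Finset (Fin n)} {x : Fin n → B} (hx : ∀ i, x i ∈ topNil p B)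
    {ρ : MvPowerSeries (Fin n) B →ₐ[B] MvPowerSeries (Fin n) B}
    (hρ : ∀ i, ρ (X i) = if i ∈ S then C (x i) else X i) (f : MvPowerSeries (Fin n) B) :
    keepVars B Sᶜ (ρ f) = ρ f := by
  have := isHausdorff_topNilSeries_quotient p B (⊥ : Ideal (MvPowerSeries (Fin n) B))
  refine (sub_eq_zero.mp (ringHom_sub_mem_of_isHausdorff ⊥ (topNilSeries p B (Fin n))
    (φ := ρ.toRingHom) (ψ := ((keepVars B Sᶜ).comp ρ).toRingHom) (fun c => ?_) (fun i => ?_)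
    (fun i => ?_) f)).symm
  · simp [algHom_C]
  · by_cases hi : i ∈ S
    · simp [hρ, hi, algHom_C]
    · simp [hρ, hi, keepVars_X]
  · by_cases hi : i ∈ S
    · simpa [hρ, hi, topNilSeries] using hx i
    · simp [hρ, hi, topNilSeries]

/-- `M` is generated by the constant values themselves. They are attained at almost all points, so
they are roots of unity of `p`-power order and lie in almost all fields of definition. -/
theorem exists_roots_of_eventually_pow_eq {Ω : Type*} (𝒰 : Ultrafilter Ω)
    (t : Ω → TorsionPoint p F n) {b : Ω → Fin n → ℤ_[p]} {S : Finset (Fin n)}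
    {ε : Fin n → AlgebraicClosure F}
    (h : ∀ i ∈ S, ∀ᶠ ω in (𝒰 : Filter Ω), (t ω).pow (b ω i) = ε i) :
    ∃ M : IntermediateField F (AlgebraicClosure F), FiniteDimensional F M ∧
      ∃ ζ : Fin n → Integers p M, (∀ i, ∃ k : ℕ, ζ i ^ p ^ k = 1) ∧
        ∀ᶠ ω in (𝒰 : Filter Ω), M ≤ (t ω).field ∧
          ∀ i ∈ S, (t ω).pow (b ω i) = toClosure p M (ζ i) := by
  obtain ⟨M, hM⟩ : ∃ M, M = IntermediateField.adjoin F (ε '' (S : Set (Fin n))) := ⟨_, rfl⟩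
  have : Finite (ε '' (S : Set (Fin n))) := (S.finite_toSet.image ε).to_subtype
  have hfin : FiniteDimensional F M := hM ▸
    IntermediateField.finiteDimensional_adjoin fun x _ => Algebra.IsIntegral.isIntegral x
  have hε : ∀ᶠ ω in (𝒰 : Filter Ω), ∀ i ∈ S, (t ω).pow (b ω i) = ε i :=
    (Filter.eventually_all_finset S).mpr h
  have hζ : ∀ i, ∃ z : Integers p M, (∃ k : ℕ, z ^ p ^ k = 1) ∧
      (i ∈ S → toClosure p M z = ε i) := by
    intro i
    by_cases hi : i ∈ S
    · obtain ⟨ω, hω⟩ := hε.exists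
      have hk : ε i ^ p ^ (t ω).level = 1 := by rw [← hω i hi, (t ω).pow_pow_level]
      obtain ⟨z, hz⟩ := exists_toClosure_eq (p := p) (L := M)
        (hM ▸ IntermediateField.subset_adjoin F _ ⟨i, hi, rfl⟩) hk
      exact ⟨z, ⟨(t ω).level, toClosure_injective (by rw [map_pow, hz, hk, map_one])⟩, fun _ => hz⟩
    -- Outside `S` any root of unity will do, since the ideal only involves `S`.
    · exact ⟨1, ⟨0, one_pow _⟩, fun h => absurd h hi⟩
  choose ζ hζ1 hζ2 using hζ
  refine ⟨M, hfin, ζ, hζ1, ?_⟩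
  filter_upwards [hε] with ω hω
  refine ⟨hM ▸ IntermediateField.adjoin_le_iff.mpr ?_, fun i hi => by rw [hω i hi, hζ2 i hi]⟩
  rintro _ ⟨i, hi, rfl⟩
  exact hω i hi ▸ (t ω).pow_mem _

/-- A power series that vanishes at almost all members of a family of torsion points which is
generic in the coordinates outside `S` vanishes on an intersection of hyperplanes. -/
theorem mem_hyperplanesIdeal_of_eventually {Ω : Type*} {𝒰 : Ultrafilter Ω}
    {t : Ω → TorsionPoint p F n} {b : Ω → Fin n → ℤ_[p]} {S : Finset (Fin n)}
    (hgen : ∀ τ : Fin n → ℤ_[p], (∃ i ∈ Sᶜ, τ i ≠ 0) →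
      ∀ᶠ ω in (𝒰 : Filter Ω), (t ω).pow (∑ i ∈ Sᶜ, τ i * b ω i) ≠ 1)
    {M : IntermediateField F (AlgebraicClosure F)} [FiniteDimensional F M]
    {ζ : Fin n → Integers p M} (hζt : ∀ i, ζ i - 1 ∈ topNil p (Integers p M))
    {g : PSeries p M n}
    (hg : ∀ᶠ ω in (𝒰 : Filter Ω), ∃ hM : M ≤ (t ω).field,
      (∀ i ∈ S, (t ω).pow (b ω i) = toClosure p M (ζ i)) ∧ (t ω).evalOver hM (b ω) g = 0) :
    g ∈ hyperplanesIdeal p F M S ζ := by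
  obtain ⟨ρ, hρ⟩ := exists_algHom_X (σ := Fin n) (τ := Fin n) p (Integers p M)
    (fun i => if i ∈ S then C (ζ i - 1) else X i) (fun i => by
      split_ifs
      · simpa [topNilSeries] using hζt i
      · simp [topNilSeries])
  have hρ0 : ρ g = 0 := by
    refine eq_zero_of_eventually_evalCurve_eq_zero (𝒰 := 𝒰) (s := Sᶜ)
      (fun ω => (t ω).isPrimitiveRoot) (fun ω => (t ω).root_sub_one_mem) (a := b) ?_
      (keepVars_compl_of_map_X hζt hρ g) ?_
    · intro τ hτ
      filter_upwards [hgen τ hτ] with ω hω h1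
      exact hω (by rw [TorsionPoint.pow, h1, map_one])
    · filter_upwards [hg] with ω ⟨hM, hω, h0⟩
      exact ⟨inclusionIntegers hM, ((t ω).evalOver_comp hM hω hρ g).trans h0⟩
  have h1 := sub_mem_span_of_map_X (S : Set (Fin n)) (fun i _ => hζt i) (φ := ρ)
    (fun i hi => (hρ i).trans (if_pos hi)) (fun i hi => (hρ i).trans (if_neg hi)) g
  rw [hρ0, sub_zero] at h1
  exact h1

/-- The power series that vanish at almost all members of a family of torsion points form, up to
a multiplicative change of variables, the ideal of an intersection of hyperplanes. -/
theorem exists_isMultChange_eventually_mem_ker {Ω : Type*} (𝒰 : Ultrafilter Ω)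
    (t : Ω → TorsionPoint p F n) :
    ∃ (θ : PSeries p F n →ₐ[Integers p F] PSeries p F n) (S : Set (Fin n))
      (H : Ideal (PSeries p F n)), IsMultChange p (Integers p F) θ ∧ Function.Surjective θ ∧
      IsHyperplaneIntersection p F S H ∧
      (∀ᶠ ω in (𝒰 : Filter Ω), H.comap θ ≤ RingHom.ker (t ω).eval) ∧
      ∀ f, (∀ᶠ ω in (𝒰 : Filter Ω), f ∈ RingHom.ker (t ω).eval) → f ∈ H.comap θ := by
  obtain ⟨θ, b, S, ε, h, hgen⟩ := exists_isAdapted_generic (Integers p F) 𝒰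
    (fun ω => (t ω).exponent) (fun ω => (t ω).pow_add) (fun ω => (t ω).pow_zero)
    (fun ω => (t ω).pow_pow_level_mul)
  obtain ⟨M, hfin, ζ, hζ, hev⟩ := exists_roots_of_eventually_pow_eq 𝒰 t h.eventually_eq
  obtain ⟨H, hH⟩ : ∃ H, H = (hyperplanesIdeal p F M S ζ).comap (extendScalars p F M) := ⟨_, rfl⟩
  refine ⟨θ, S, H, h.isMultChange, h.surjective, ⟨M, hfin, ζ, hζ, hH⟩, ?_, fun f hf => ?_⟩
  · filter_upwards [hev] with ω ⟨hM, hω⟩ f hf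
    rw [Ideal.mem_comap, hH, Ideal.mem_comap] at hf
    rw [RingHom.mem_ker, ← (t ω).evalOver_extendScalars hM (h.curve_eq ω)]
    exact (t ω).hyperplanesIdeal_le_ker_evalOver hM hω hf
  · rw [Ideal.mem_comap, hH, Ideal.mem_comap]
    refine mem_hyperplanesIdeal_of_eventually hgen
      (fun i => sub_one_mem_topNil p _ (hζ i).choose_spec) ?_
    filter_upwards [hev, hf] with ω ⟨hM, hω⟩ h0
    exact ⟨hM, hω, ((t ω).evalOver_extendScalars hM (h.curve_eq ω) f).trans h0⟩

end Families

/-! ### From ultrafilters to irreducible components. -/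

section Components

/-- If each ultrafilter on `E` contains the set of specializations in `E` of a point `q` of the
closure with the property `P`, then the irreducible components of the closure of `E` are the
closures of such points. -/
theorem exists_closure_singleton_eq_of_mem_irreducibleComponents {X : Type*} [TopologicalSpace X]
    {E : Set X} {P : X → Prop}
    (hE : ∀ 𝒰 : Ultrafilter E, ∃ q ∈ closure E, P q ∧ ∀ᶠ e : E in (𝒰 : Filter E), q ⤳ (e : X))
    {Z : Set (closure E)} (hZ : Z ∈ irreducibleComponents (closure E)) :
    ∃ q, P q ∧ Subtype.val '' Z = closure {q} := by
  classical
  obtain ⟨T, hT, hTE⟩ : ∃ T : Finset X, (∀ q ∈ T, q ∈ closure E ∧ P q) ∧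
      ∀ e ∈ E, ∃ q ∈ T, q ⤳ e := by
    -- If no finite `T` worked, the sets of points that are not specializations of a given `q` would
    -- have the finite intersection property, and an ultrafilter containing them all would
    -- contradict `hE`.
    by_contra! hcon
    let 𝒮 : Set (Set E) := {s | ∃ q, (q ∈ closure E ∧ P q) ∧ s = {e : E | ¬ q ⤳ (e : X)}}
    obtain ⟨𝒰, h𝒰⟩ := Ultrafilter.exists_ultrafilter_of_finite_inter_nonempty 𝒮 fun T hT => by
      choose f hf hf' using hT
      obtain ⟨e, he, hne⟩ := hcon (T.attach.image fun s => f s.2) fun q hq => by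
        obtain ⟨s, -, rfl⟩ := Finset.mem_image.mp hq
        exact hf s.2
      refine ⟨⟨e, he⟩, fun s hs => ?_⟩
      rw [hf' hs]
      exact hne _ (Finset.mem_image_of_mem (fun s => f s.2) (Finset.mem_attach T ⟨s, hs⟩))
    obtain ⟨q, hq, hPq, hq𝒰⟩ := hE 𝒰
    obtain ⟨e, h1, h2⟩ := (hq𝒰.and (h𝒰 ⟨q, ⟨hq, hPq⟩, rfl⟩)).exists
    exact h2 h1
  have hcl : closure E ⊆ ⋃₀ ↑(T.image fun q => closure {q}) := by
    refine closure_minimal (fun e he => ?_) ?_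
    · obtain ⟨q, hq, hqe⟩ := hTE e he
      exact ⟨_, Finset.mem_coe.mpr (Finset.mem_image_of_mem _ hq), hqe.mem_closure⟩
    · rw [Set.sUnion_eq_biUnion]
      refine (Finset.finite_toSet _).isClosed_biUnion fun s hs => ?_
      obtain ⟨q, -, rfl⟩ := Finset.mem_image.mp (Finset.mem_coe.mp hs)
      exact isClosed_closure
  have hirr : IsIrreducible (Subtype.val '' Z) :=
    hZ.prop.image _ continuous_subtype_val.continuousOn
  obtain ⟨s, hs, hZs⟩ := isIrreducible_iff_sUnion_isClosed.mp hirr (T.image fun q => closure {q})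
    (fun s hs => by
      obtain ⟨q, -, rfl⟩ := Finset.mem_image.mp hs
      exact isClosed_closure)
    ((Subtype.coe_image_subset _ _).trans hcl)
  obtain ⟨q, hq, rfl⟩ := Finset.mem_image.mp hs
  obtain ⟨hqE, hPq⟩ := hT q hq
  refine ⟨q, hPq, hZs.antisymm ?_⟩
  have hqcl : closure {q} ⊆ closure E := closure_minimal (by simpa using hqE) isClosed_closure
  have hsub : closure {(⟨q, hqE⟩ : closure E)} = Subtype.val ⁻¹' closure {q} := by
    rw [Topology.IsInducing.subtypeVal.closure_eq_preimage_closure_image, Set.image_singleton]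
  -- The component `Z` lies in this irreducible closed set, so maximality forces equality.
  have hle : closure {(⟨q, hqE⟩ : closure E)} ≤ Z := hZ.le_of_ge isIrreducible_singleton.closure (by
    rw [hsub]
    exact Set.image_subset_iff.mp hZs)
  intro x hx
  exact ⟨⟨x, hqcl hx⟩, hle (hsub ▸ hx), rfl⟩

variable {p : ℕ} [Fact p.Prime] {F : Type*} [Field F] [Algebra ℚ_[p] F]
  [FiniteDimensional ℚ_[p] F] [Algebra ℤ_[p] F] [IsScalarTower ℤ_[p] ℚ_[p] F] {n : ℕ}

/-- The series vanishing at almost all points form a prime ideal, because an ultrafilter decides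
disjunctions. It contains every series vanishing at all special points, so the prime lies in their
closure. -/
theorem exists_eventually_specializes {I : Ideal (PSeries p F n)}
    (𝒰 : Ultrafilter (specialPoints p F I)) : ∃ q ∈ closure (specialPoints p F I),
      IsSpecialSubscheme p F (q.asIdeal.comap (Ideal.Quotient.mk I)) ∧
        ∀ᶠ e : specialPoints p F I in (𝒰 : Filter (specialPoints p F I)), q ⤳ e.1 := by
  choose t ht using fun e : specialPoints p F I => exists_torsionPoint e.2
  obtain ⟨θ, S, H, hθ, hsurj, hH, hle, hmem⟩ := exists_isMultChange_eventually_mem_ker 𝒰 t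
  have hiff : ∀ f, f ∈ H.comap θ ↔
      ∀ᶠ e in (𝒰 : Filter (specialPoints p F I)), f ∈ RingHom.ker (t e).eval := fun f =>
    ⟨fun hf => hle.mono fun e he => he hf, hmem f⟩
  have hI : I ≤ H.comap θ := fun f hf => hmem f <| .of_forall fun e => by
    rw [← ht e, Ideal.mem_comap, Ideal.Quotient.eq_zero_iff_mem.mpr hf]
    exact Ideal.zero_mem _
  have hprime : (H.comap θ).IsPrime := by
    refine ⟨fun h => ?_, fun {f g} hfg => ?_⟩
    · obtain ⟨e, he⟩ := ((hiff 1).mp (h ▸ Submodule.mem_top)).exists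
      rw [RingHom.mem_ker, map_one] at he
      exact one_ne_zero he
    · rw [hiff, hiff, ← Ultrafilter.eventually_or]
      filter_upwards [(hiff _).mp hfg] with e he
      exact (RingHom.ker_isPrime _).mem_or_mem he
  have hcomap : ((H.comap θ).map (Ideal.Quotient.mk I)).comap (Ideal.Quotient.mk I) = H.comap θ :=
    Ideal.comap_map_mk hI
  have hprime' : ((H.comap θ).map (Ideal.Quotient.mk I)).IsPrime :=
    Ideal.map_isPrime_of_surjective Ideal.Quotient.mk_surjective (by rwa [Ideal.mk_ker])
  refine ⟨⟨_, hprime'⟩, ?_, ⟨θ, hθ, {H}, Set.finite_singleton _, ?_, ?_⟩, ?_⟩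
  · rw [← PrimeSpectrum.zeroLocus_vanishingIdeal_eq_closure, PrimeSpectrum.mem_zeroLocus]
    intro f hf
    obtain ⟨g, rfl⟩ := Ideal.Quotient.mk_surjective f
    refine Ideal.mem_map_of_mem _ (hmem g <| .of_forall fun e => ?_)
    rw [← ht e]
    exact (PrimeSpectrum.mem_vanishingIdeal _ _).mp hf e e.2
  · rintro _ rfl
    exact ⟨S, hH⟩
  · rw [hcomap, sInf_singleton]
    exact Ideal.map_comap_of_surjective θ hsurj H
  · filter_upwards [hle] with e he
    rw [← PrimeSpectrum.le_iff_specializes]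
    exact Ideal.map_le_iff_le_comap.mpr (he.trans (ht e).ge)

end Components

end

end FormalManinMumford

theorem theorem2p15 (p : ℕ) [Fact p.Prime] (F : Type*) [Field F] [Algebra ℚ_[p] F]
    [FiniteDimensional ℚ_[p] F] [Algebra ℤ_[p] F] [IsScalarTower ℤ_[p] ℚ_[p] F]
    (n : ℕ) (I : Ideal (FormalManinMumford.PSeries p F n))
    (Z : Set (closure (FormalManinMumford.specialPoints p F I)))
    (hZ : Z ∈ irreducibleComponents (closure (FormalManinMumford.specialPoints p F I))) :
    FormalManinMumford.IsSpecialSubscheme p F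
      ((PrimeSpectrum.vanishingIdeal (Subtype.val '' Z)).comap (Ideal.Quotient.mk I)) := by
  obtain ⟨P, hP⟩ : ∃ P : PrimeSpectrum (FormalManinMumford.PSeries p F n ⧸ I) → Prop,
      ∀ q, P q ↔ FormalManinMumford.IsSpecialSubscheme p F
        (q.asIdeal.comap (Ideal.Quotient.mk I)) := ⟨_, fun _ => Iff.rfl⟩
  obtain ⟨q, hq, hqZ⟩ :=
    FormalManinMumford.exists_closure_singleton_eq_of_mem_irreducibleComponents (P := P)
      (fun 𝒰 => by
        obtain ⟨q, h1, h2, h3⟩ := FormalManinMumford.exists_eventually_specializes 𝒰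
        exact ⟨q, h1, (hP q).mpr h2, h3⟩) hZ
  have h : PrimeSpectrum.vanishingIdeal (Subtype.val '' Z) = q.asIdeal := by
    rw [hqZ, PrimeSpectrum.vanishingIdeal_closure, PrimeSpectrum.vanishingIdeal_singleton]
  rw [h]
  exact (hP q).mp hq
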